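/- Let $d\ge 1$. For a Lebesgue measurable set $E\subset\mathbb{R}^d$ let $P(E)=\sup\{-\int_E \operatorname{div}\xi\,dx:\ \xi\in C^1_c(\mathbb{R}^d;\mathbb{R}^d),\ |\xi|\le 1\}$ be its perimeter, and let $$W_2^2(\chi_E,\chi_F)=\inf_\gamma \iint |x-y|^2\,d\gamma(x,y),$$ where the infimum is over all finite measures $\gamma$ on $\mathbb{R}^d\times\mathbb{R}^d$ with marginals $\chi_E(x)\,dx$ and $\chi_F(y)\,dy$ (it is $+\infty$ if there are none). Let $k:\mathbb{R}^d\to[0,\infty)$ be integrable with $k(-z)=k(z)$ and $\int k=1$, and set $\mathcal{E}(E)=P(E)+\int_E k*\chi_E\,dx$. Let $E_0\subset\mathbb{R}^d$ be Lebesgue measurable with $P(E_0)<\infty$ and $\int_{E_0}(1+|x|^2)\,dx<\infty$. For a time step $h>0$ let the measurable sets $E_1,E_2,\dots$ be such that, for each $n\ge1$, $E_n$ minimizes $$E\mapsto \frac1{2h}W_2^2(\chi_E,\chi_{E_{n-1}})+P(E)+\int_E k*\chi_E\,dx$$ among all Lebesgue measurable sets $E\subset\mathbb{R}^d$, and put $E_h(t)=E_{\lfloor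 t/h\rfloor}$ for $t\ge0$. **Lemma (Compactness).** There is a constant $C=C(d)$, depending only on $d$, such that for all such $k$, $E_0$ the following holds. (i) For every $h>0$, every discrete solution $E_h$ as above and all $t>s\ge0$ with $t-s\ge h$, $$W_2(\chi_{E_h(t)},\chi_{E_h(s)})\le C\,\mathcal{E}(E_0)^{1/2}(t-s)^{1/2},\qquad |E_h(t)\triangle E_h(s)|\le C\,|E_0|^{1/4}\,\mathcal{E}(E_0)^{3/4}(t-s)^{1/4}.$$ (ii) For every sequence of time steps $h_j>0$ with $h_j\to0$ and discrete solutions $E_{h_j}$ as above, there are a subsequence (not relabelled) and a family $(E(t))_{t\ge0}$ of sets of finite perimeter such that, for every $T<\infty$, $$\sup_{t\in[0,T]}|E_{h_j}(t)\triangle E(t)|\to0\quad\text{as } j\to\infty,$$ and, for all $t>s\ge0$, $$W_2(\chi_{E(t)},\chi_{E(s)})\le C\,\mathcal{E}(E_0)^{1/2}(t-s)^{1/2},\qquad |E(t)\triangle E(s)|\le C\,|E_0|^{1/4}\,\mathcal{E}(E_0)^{3/4}(t-s)^{1/4}.$$ In particular, under the normalization $|E_0|=1$ the factor $|E_0|^{1/4}$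 equals $1$. -/

import Mathlib

open MeasureTheory Filter Topology
open scoped ENNReal symmDiff

namespace FerroFlow

noncomputable section

/-- The divergence of a vector field on `ℝ^d`. -/
def divergence {d : ℕ} (ξ : EuclideanSpace ℝ (Fin d) → EuclideanSpace ℝ (Fin d))
    (x : EuclideanSpace ℝ (Fin d)) : ℝ :=
  ∑ i : Fin d, (fderiv ℝ ξ x (EuclideanSpace.single i 1)) i

/-- The perimeter `P(E) = sup { - ∫_E div ξ : ξ ∈ C_c^1(ℝ^d; ℝ^d), |ξ| ≤ 1 }`. -/
def perimeter {d : ℕ} (E : Set (EuclideanSpace ℝ (Fin d))) : ℝ≥0∞ :=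
  ⨆ (ξ : EuclideanSpace ℝ (Fin d) → EuclideanSpace ℝ (Fin d))
    (_ : ContDiff ℝ 1 ξ) (_ : HasCompactSupport ξ) (_ : ∀ x, ‖ξ x‖ ≤ 1),
    ENNReal.ofReal (-∫ x in E, divergence ξ x)

/-- A set of finite perimeter: Lebesgue measurable (that is, measurable for the completion of the
Borel σ-algebra with respect to `volume`) with finite perimeter. -/
def HasFinitePerimeter {d : ℕ} (E : Set (EuclideanSpace ℝ (Fin d))) : Prop :=
  NullMeasurableSet E volume ∧ perimeter E < ∞

/-- `γ` is a transport plan from `χ_E dx` to `χ_F dy`. -/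
def IsTransportPlan {d : ℕ} (E F : Set (EuclideanSpace ℝ (Fin d)))
    (γ : Measure (EuclideanSpace ℝ (Fin d) × EuclideanSpace ℝ (Fin d))) : Prop :=
  IsFiniteMeasure γ ∧ γ.map Prod.fst = volume.restrict E ∧ γ.map Prod.snd = volume.restrict F

/-- The squared Wasserstein distance `W_2²(χ_E, χ_F)`; it is `∞` if there is no transport plan. -/
def W2sq {d : ℕ} (E F : Set (EuclideanSpace ℝ (Fin d))) : ℝ≥0∞ :=
  ⨅ (γ : Measure (EuclideanSpace ℝ (Fin d) × EuclideanSpace ℝ (Fin d)))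
    (_ : IsTransportPlan E F γ), ∫⁻ p, ‖p.1 - p.2‖ₑ ^ 2 ∂γ

/-- The Wasserstein distance `W_2(χ_E, χ_F)`. -/
def W2 {d : ℕ} (E F : Set (EuclideanSpace ℝ (Fin d))) : ℝ≥0∞ :=
  W2sq E F ^ (1 / 2 : ℝ)

/-- A non-negative, symmetric, normalized convolution kernel. -/
structure IsKernel {d : ℕ} (k : EuclideanSpace ℝ (Fin d) → ℝ) : Prop where
  nonneg : ∀ z, 0 ≤ k z
  symm : ∀ z, k (-z) = k z
  integrable : Integrable k volume
  integral_eq_one : ∫ z, k z = 1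

/-- The convolution `k * χ_E` of a non-negative kernel with a characteristic function. -/
def convIndicator {d : ℕ} (k : EuclideanSpace ℝ (Fin d) → ℝ)
    (E : Set (EuclideanSpace ℝ (Fin d))) (x : EuclideanSpace ℝ (Fin d)) : ℝ≥0∞ :=
  ∫⁻ y in E, ENNReal.ofReal (k (x - y))

/-- The total energy `P(E) + ∫_E k * χ_E dx`. -/
def energy {d : ℕ} (k : EuclideanSpace ℝ (Fin d) → ℝ)
    (E : Set (EuclideanSpace ℝ (Fin d))) : ℝ≥0∞ :=
  perimeter E + ∫⁻ x in E, convIndicator k E x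

/-- The functional `E ↦ W_2²(χ_E, χ_F) / (2h) + P(E) + ∫_E k * χ_E dx`, where `F` is the
previous set. -/
def stepFunctional {d : ℕ} (k : EuclideanSpace ℝ (Fin d) → ℝ) (h : ℝ)
    (F E : Set (EuclideanSpace ℝ (Fin d))) : ℝ≥0∞ :=
  W2sq E F / ENNReal.ofReal (2 * h) + energy k E

/-- `E 0, E 1, E 2, …` is produced by the minimizing movements scheme with time step `h`
started at `E₀`: each `E (n + 1)` minimizes the step functional with previous set `E n`
among all Lebesgue measurable sets. -/
structure IsMinimizingMovement {d : ℕ} (k : EuclideanSpace ℝ (Fin d) → ℝ) (h : ℝ)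
    (E₀ : Set (EuclideanSpace ℝ (Fin d))) (E : ℕ → Set (EuclideanSpace ℝ (Fin d))) : Prop where
  init : E 0 = E₀
  measurable : ∀ n, NullMeasurableSet (E n) volume
  minimal : ∀ n, ∀ F : Set (EuclideanSpace ℝ (Fin d)), NullMeasurableSet F volume →
    stepFunctional k h (E n) (E (n + 1)) ≤ stepFunctional k h (E n) F

/-- The piecewise constant interpolation `E_h(t) = E_{[t/h]}`, for `t ≥ 0`. -/
def interpolate {d : ℕ} (h : ℝ) (E : ℕ → Set (EuclideanSpace ℝ (Fin d))) (t : ℝ) :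
    Set (EuclideanSpace ℝ (Fin d)) :=
  E ⌊t / h⌋₊

/-- Admissible initial conditions: `E₀` is Lebesgue measurable, `P(E₀) < ∞` and
`∫_{E₀} (1 + |x|²) dx < ∞`. -/
structure IsInitialCondition {d : ℕ} (E₀ : Set (EuclideanSpace ℝ (Fin d))) : Prop where
  measurable : NullMeasurableSet E₀ volume
  perimeter_lt_top : perimeter E₀ < ∞
  moment_lt_top : ∫⁻ x in E₀, ENNReal.ofReal (1 + ‖x‖ ^ 2) < ∞

end

end FerroFlow

/-!
Each minimality inequality, tested with the previous set, bounds `W₂²` of the step by `2h` times the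
energy drop; summing and using Cauchy–Schwarz gives Hölder continuity of order `1/2` for `W₂`. To
pass to `L¹`, write `|A ∆ B|` as the integral of a function `|g| ≤ 1` against `χ_A - χ_B` and
mollify `g` at scale `r`: the error is at most `r` times the perimeters, and the mollified function
is Lipschitz with constant of order `1/r`, so that `W₂` controls its integral. Optimizing in `r`
gives `|A ∆ B|² ≲ P |A|^{1/2} W₂`, that is, Hölder continuity of order `1/4`.

The same mollification shows that sets of given volume with bounded perimeter and second moment are
totally bounded in `L¹`: up to a small error, the integral of the mollified function only depends on
the masses that the set assigns to finitely many cells. Compactness is then the Arzelà–Ascoli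
theorem in the complete space of measurable sets modulo null sets, applied to discrete solutions
that are equicontinuous only asymptotically, as `h → 0`. The bounds on the perimeter and on `W₂`
pass to the limit by lower semicontinuity.
-/

namespace FerroFlow

open scoped NNReal

section SymmetricDifference

variable {α : Type*} [MeasurableSpace α] {μ : Measure α} {A B : Set α}

theorem measure_symmDiff_congr {A' B' : Set α} (hA : A =ᵐ[μ] A') (hB : B =ᵐ[μ] B') :
    μ (A ∆ B) = μ (A' ∆ B') :=
  measure_congr (ae_eq_set_symmDiff hA hB)

theorem restrict_compl_le_measure_symmDiff (hB : MeasurableSet B) :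
    μ.restrict A Bᶜ ≤ μ (A ∆ B) := by
  rw [Measure.restrict_apply hB.compl]
  exact measure_mono fun x hx ↦ Or.inl ⟨hx.2, hx.1⟩

theorem measureReal_symmDiff_eq₀ (hA : NullMeasurableSet A μ) (hB : NullMeasurableSet B μ)
    (hAB : μ (A ∆ B) ≠ ∞) : μ.real (A ∆ B) = μ.real (A \ B) + μ.real (B \ A) :=
  measureReal_union₀ (hB.diff hA) (disjoint_sdiff_sdiff.aedisjoint)
    (measure_ne_top_of_subset Set.subset_union_left hAB)
    (measure_ne_top_of_subset Set.subset_union_right hAB)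

theorem setIntegral_sub_setIntegral {f : α → ℝ} (hA : NullMeasurableSet A μ)
    (hB : NullMeasurableSet B μ) (hfA : IntegrableOn f A μ) (hfB : IntegrableOn f B μ) :
    ∫ x in A, f x ∂μ - ∫ x in B, f x ∂μ = ∫ x in A \ B, f x ∂μ - ∫ x in B \ A, f x ∂μ := by
  rw [← integral_inter_add_sdiff₀ hB hfA, ← integral_inter_add_sdiff₀ hA hfB, Set.inter_comm]
  ring

theorem abs_setIntegral_sub_setIntegral_le {f : α → ℝ} {M : ℝ} (hA : NullMeasurableSet A μ)
    (hB : NullMeasurableSet B μ) (hAB : μ (A ∆ B) ≠ ∞) (hf : Integrable f μ)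
    (hM : ∀ x, |f x| ≤ M) : |∫ x in A, f x ∂μ - ∫ x in B, f x ∂μ| ≤ M * μ.real (A ∆ B) := by
  have hdiff {S : Set α} (hS : S ⊆ A ∆ B) : |∫ x in S, f x ∂μ| ≤ M * μ.real S :=
    norm_setIntegral_le_of_norm_le_const (f := f) (measure_ne_top_of_subset hS hAB).lt_top
      fun x _ ↦ hM x
  rw [setIntegral_sub_setIntegral hA hB hf.integrableOn hf.integrableOn,
    measureReal_symmDiff_eq₀ hA hB hAB, mul_add]
  exact (abs_sub _ _).trans
    (add_le_add (hdiff Set.subset_union_left) (hdiff Set.subset_union_right))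

theorem setLIntegral_le_add_measure_symmDiff {f : α → ℝ≥0∞} {R : ℝ≥0∞} (hf : ∀ x, f x ≤ R) :
    ∫⁻ x in B, f x ∂μ ≤ ∫⁻ x in A, f x ∂μ + R * μ (A ∆ B) := by
  calc ∫⁻ x in B, f x ∂μ ≤ ∫⁻ x in A ∆ B ∪ A, f x ∂μ :=
      lintegral_mono_set (le_symmDiff_sup_left A B)
    _ ≤ ∫⁻ x in A ∆ B, f x ∂μ + ∫⁻ x in A, f x ∂μ := lintegral_union_le _ _ _
    _ ≤ ∫⁻ x in A, f x ∂μ + R * μ (A ∆ B) := by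
      rw [add_comm, ← setLIntegral_const]
      gcongr
      exact hf _

variable {ι : Type*} {l : Filter ι} {S : ι → Set α}

theorem tendsto_setIntegral_of_tendsto_symmDiff (hS : ∀ i, NullMeasurableSet (S i) μ)
    (hB : NullMeasurableSet B μ) (hSB : Tendsto (fun i ↦ μ (S i ∆ B)) l (𝓝 0)) {f : α → ℝ}
    (hf : Integrable f μ) {M : ℝ} (hM : ∀ x, |f x| ≤ M) :
    Tendsto (fun i ↦ ∫ x in S i, f x ∂μ) l (𝓝 (∫ x in B, f x ∂μ)) := by
  rw [tendsto_iff_dist_tendsto_zero]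
  have hbound : Tendsto (fun i ↦ M * μ.real (S i ∆ B)) l (𝓝 0) := by
    simpa [Measure.real] using ((ENNReal.tendsto_toReal ENNReal.zero_ne_top).comp hSB).const_mul M
  refine squeeze_zero' (.of_forall fun _ ↦ dist_nonneg) ?_ hbound
  filter_upwards [hSB.eventually_lt_const ENNReal.zero_lt_top] with i hi
  exact abs_setIntegral_sub_setIntegral_le (hS i) hB hi.ne hf hM

theorem setLIntegral_le_of_tendsto_symmDiff [l.NeBot]
    (hSB : Tendsto (fun i ↦ μ (S i ∆ B)) l (𝓝 0)) {f : α → ℝ≥0∞} (hf : Measurable f)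
    {M : ℝ≥0∞} (hM : ∀ i, ∫⁻ x in S i, f x ∂μ ≤ M) : ∫⁻ x in B, f x ∂μ ≤ M := by
  have hmono : Monotone fun (n : ℕ) x ↦ min (f x) n := fun a b hab x ↦
    min_le_min_left _ (Nat.cast_le.2 hab)
  have hsup (x : α) : f x = ⨆ n : ℕ, min (f x) n := by
    rw [← inf_iSup_eq, ENNReal.iSup_natCast, inf_top_eq]
  rw [lintegral_congr hsup, lintegral_iSup (fun n ↦ by fun_prop) hmono]
  refine iSup_le fun n ↦ ?_
  have hlim : Tendsto (fun i ↦ M + n * μ (S i ∆ B)) l (𝓝 M) := by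
    simpa using (ENNReal.Tendsto.const_mul hSB (.inr (ENNReal.natCast_ne_top n))).const_add M
  refine ge_of_tendsto' hlim fun i ↦
    (setLIntegral_le_add_measure_symmDiff (A := S i) fun x ↦ min_le_right _ _).trans ?_
  gcongr
  exact (lintegral_mono fun x ↦ min_le_left _ _).trans (hM i)

theorem measure_eq_of_tendsto_symmDiff [l.NeBot] {c : ℝ≥0∞}
    (hSB : Tendsto (fun i ↦ μ (S i ∆ B)) l (𝓝 0)) (hc : ∀ i, μ (S i) = c) : μ B = c := by
  refine le_antisymm ?_ (ge_of_tendsto' (by simpa using hSB.const_add (μ B)) fun i ↦ ?_)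
  · simpa using setLIntegral_le_of_tendsto_symmDiff hSB measurable_one (M := c) (by simp [hc])
  · rw [← tsub_le_iff_left, ← hc i]
    exact le_measure_symmDiff

end SymmetricDifference

section Perimeter

theorem hasDerivAt_integral_comp_sub_smul {V : Type*} [NormedAddCommGroup V] [NormedSpace ℝ V]
    [MeasurableSpace V] [OpensMeasurableSpace V] (μ : Measure V) [IsFiniteMeasure μ] {g : V → ℝ}
    (hg : ContDiff ℝ 1 g) (hc : HasCompactSupport g) (y : V) (s : ℝ) :
    HasDerivAt (fun s : ℝ ↦ ∫ x, g (x - s • y) ∂μ) (-∫ x, fderiv ℝ g (x - s • y) y ∂μ) s := by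
  have hg' : Continuous (fderiv ℝ g) := hg.continuous_fderiv one_ne_zero
  obtain ⟨B, hB⟩ := hc.exists_bound_of_continuous hg.continuous
  obtain ⟨B', hB'⟩ := (hc.fderiv ℝ).exists_bound_of_continuous hg'
  rw [← integral_neg]
  refine (hasDerivAt_integral_of_dominated_loc_of_deriv_le (s := Set.univ) univ_mem
    (F := fun s x ↦ g (x - s • y)) (F' := fun s x ↦ -fderiv ℝ g (x - s • y) y)
    (bound := fun _ ↦ B' * ‖y‖) (.of_forall fun s ↦ ?_) ?_ ?_ (.of_forall fun x s _ ↦ ?_)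
    (integrable_const _) (.of_forall fun x s _ ↦ ?_)).2
  · exact (hg.continuous.comp (by fun_prop)).aestronglyMeasurable
  · exact .of_bound (hg.continuous.comp (by fun_prop)).aestronglyMeasurable B
      (.of_forall fun x ↦ hB _)
  · exact ((hg'.comp (by fun_prop)).clm_apply continuous_const).neg.aestronglyMeasurable
  · rw [norm_neg]
    exact (fderiv ℝ g (x - s • y)).le_of_opNorm_le (hB' _) y
  · have hline : HasDerivAt (fun s : ℝ ↦ x - s • y) (-y) s := by
      simpa only [id, one_smul] using ((hasDerivAt_id s).smul_const y).const_sub x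
    simpa only [Function.comp_def, map_neg] using
      (hg.differentiable one_ne_zero _).hasFDerivAt.comp_hasDerivAt s hline

variable {d : ℕ}

theorem divergence_const_smul {ξ : EuclideanSpace ℝ (Fin d) → EuclideanSpace ℝ (Fin d)}
    (hξ : Differentiable ℝ ξ) (c : ℝ) (x : EuclideanSpace ℝ (Fin d)) :
    divergence (fun z ↦ c • ξ z) x = c * divergence ξ x := by
  simp only [divergence, Finset.mul_sum, fderiv_fun_const_smul (hξ x), smul_apply, PiLp.smul_apply,
    smul_eq_mul]

theorem divergence_smul_const {g : EuclideanSpace ℝ (Fin d) → ℝ} (hg : Differentiable ℝ g)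
    (y x : EuclideanSpace ℝ (Fin d)) :
    divergence (fun z ↦ g z • y) x = fderiv ℝ g x y := by
  have hy : y = ∑ i, y i • EuclideanSpace.single i (1 : ℝ) := by
    ext j
    simp [Finset.sum_apply, Pi.single_apply]
  conv_rhs => rw [hy, map_sum]
  refine Finset.sum_congr rfl fun i _ ↦ ?_
  simp [fderiv_smul_const (hg x), mul_comm]

theorem abs_setIntegral_divergence_le {A : Set (EuclideanSpace ℝ (Fin d))} (hA : perimeter A ≠ ∞)
    {ξ : EuclideanSpace ℝ (Fin d) → EuclideanSpace ℝ (Fin d)} (hξ : ContDiff ℝ 1 ξ)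
    (hc : HasCompactSupport ξ) {M : ℝ} (hM : 0 < M) (hξM : ∀ x, ‖ξ x‖ ≤ M) :
    |∫ x in A, divergence ξ x| ≤ M * (perimeter A).toReal := by
  have flux_le {c : ℝ} (hcM : |c| = M⁻¹) :
      -(c * ∫ x in A, divergence ξ x) ≤ (perimeter A).toReal := by
    rw [← integral_const_mul, ← ENNReal.ofReal_le_iff_le_toReal hA]
    simp only [← divergence_const_smul (hξ.differentiable one_ne_zero)]
    refine le_iSup_of_le (fun z ↦ c • ξ z) <| le_iSup_of_le (hξ.const_smul c) <|
      le_iSup_of_le (hc.smul_left (f := fun _ ↦ c)) <| le_iSup_of_le (fun x ↦ ?_) le_rfl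
    rw [norm_smul, Real.norm_eq_abs, hcM, inv_mul_le_iff₀ hM, mul_one]
    exact hξM x
  have hpos := flux_le (c := M⁻¹) (abs_of_pos (inv_pos.2 hM))
  have hneg := flux_le (c := -M⁻¹) (by rw [abs_neg, abs_of_pos (inv_pos.2 hM)])
  rw [neg_mul, neg_neg, inv_mul_le_iff₀ hM] at hneg
  rw [← mul_neg, inv_mul_le_iff₀ hM] at hpos
  exact abs_le'.2 ⟨hneg, hpos⟩

theorem abs_setIntegral_sub_translate_le {A : Set (EuclideanSpace ℝ (Fin d))}
    (hA : perimeter A ≠ ∞) (hvol : volume A ≠ ∞) {g : EuclideanSpace ℝ (Fin d) → ℝ}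
    (hg : ContDiff ℝ 1 g) (hc : HasCompactSupport g) (hg1 : ∀ x, |g x| ≤ 1)
    (y : EuclideanSpace ℝ (Fin d)) :
    |(∫ x in A, g x) - ∫ x in A, g (x - y)| ≤ ‖y‖ * (perimeter A).toReal := by
  rcases eq_or_ne y 0 with rfl | hy
  · simp
  have : IsFiniteMeasure (volume.restrict A) := isFiniteMeasure_restrict.2 hvol
  have norm_deriv_le (s : ℝ) :
      ‖-∫ x in A, fderiv ℝ g (x - s • y) y‖ ≤ ‖y‖ * (perimeter A).toReal := by
    have hgs : ContDiff ℝ 1 fun z ↦ g (z - s • y) := hg.comp (contDiff_id.sub contDiff_const)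
    have hcs : HasCompactSupport fun z ↦ g (z - s • y) :=
      hc.comp_homeomorph (Homeomorph.subRight (s • y))
    have := abs_setIntegral_divergence_le hA (ξ := fun z ↦ g (z - s • y) • y)
      (hgs.smul contDiff_const) hcs.smul_right (norm_pos_iff.2 hy) fun x ↦ by
        rw [norm_smul]
        exact mul_le_of_le_one_left (norm_nonneg _) (hg1 _)
    simpa only [divergence_smul_const (hgs.differentiable one_ne_zero), fderiv_comp_sub, norm_neg,
      Real.norm_eq_abs] using this
  simpa using Convex.norm_image_sub_le_of_norm_hasDerivWithin_le (s := Set.univ)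
    (fun s _ ↦ (hasDerivAt_integral_comp_sub_smul (volume.restrict A) hg hc y s).hasDerivWithinAt)
    (fun s _ ↦ norm_deriv_le s) convex_univ (Set.mem_univ 1) (Set.mem_univ 0)

end Perimeter

section Duality

theorem measureReal_sub_le_setIntegral {α : Type*} [MeasurableSpace α] {μ : Measure α}
    {A K : Set α} (hK : MeasurableSet K) (hKA : K ⊆ A)
    (hA : μ A ≠ ∞) {g : α → ℝ} (hg : IntegrableOn g A μ) (hg1 : ∀ x, |g x| ≤ 1)
    (hgK : ∀ x ∈ K, g x = 1) : μ.real A - 2 * μ.real (A \ K) ≤ ∫ x in A, g x ∂μ := by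
  have hAK : -μ.real (A \ K) ≤ ∫ x in A \ K, g x ∂μ := by
    have := norm_setIntegral_le_of_norm_le_const (μ := μ) (f := g)
      (measure_ne_top_of_subset (Set.sdiff_subset (t := K)) hA).lt_top fun x _ ↦ hg1 x
    linarith [(abs_le.1 this).1]
  have hsplit := integral_inter_add_sdiff hK hg
  rw [Set.inter_eq_self_of_subset_right hKA, setIntegral_congr_fun hK hgK,
    setIntegral_one_eq_measureReal] at hsplit
  linarith [measureReal_sdiff hKA hK hA]

theorem exists_isCompact_measureReal_sdiff_lt {α : Type*} [MeasurableSpace α]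
    [TopologicalSpace α] [T2Space α] [OpensMeasurableSpace α] {μ : Measure α}
    [μ.InnerRegularCompactLTTop] {A : Set α} (hA : NullMeasurableSet A μ) (hμA : μ A ≠ ∞) {ε : ℝ}
    (hε : 0 < ε) : ∃ K ⊆ A, IsCompact K ∧ μ.real (A \ K) < ε := by
  obtain ⟨A', hA'A, hA', hAA'⟩ := hA.exists_measurable_subset_ae_eq
  obtain ⟨K, hKA', hK, hlt⟩ := hA'.exists_isCompact_sdiff_lt
    (measure_ne_top_of_subset hA'A hμA) (ENNReal.ofReal_pos.2 hε).ne'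
  refine ⟨K, hKA'.trans hA'A, hK, ?_⟩
  rw [← measureReal_congr (hAA'.diff (ae_eq_refl K))]
  exact ENNReal.toReal_lt_of_lt_ofReal hlt

variable {V : Type*} [NormedAddCommGroup V] [NormedSpace ℝ V] [FiniteDimensional ℝ V]

theorem exists_contDiff_eq_one_eq_zero (n : ℕ∞) {K K' : Set V} (hK : IsCompact K)
    (hK' : IsCompact K') (hd : Disjoint K K') :
    ∃ g : V → ℝ, ContDiff ℝ n g ∧ HasCompactSupport g ∧ (∀ x, g x ∈ Set.Icc 0 1) ∧
      (∀ x ∈ K, g x = 1) ∧ ∀ x ∈ K', g x = 0 := by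
  obtain ⟨R, hR⟩ := hK.isBounded.subset_ball 0
  obtain ⟨g, hg, hr, h0, h1⟩ := exists_contMDiff_zero_iff_one_iff_of_isClosed
    (modelWithCornersSelf ℝ V) (n := n) (s := K' ∪ (Metric.ball 0 R)ᶜ)
    (hK'.isClosed.union Metric.isOpen_ball.isClosed_compl) hK.isClosed
    (Set.disjoint_union_left.2 ⟨hd.symm, (Set.disjoint_compl_right_iff_subset.2 hR).symm⟩)
  refine ⟨g, contMDiff_iff_contDiff.1 hg, .intro (isCompact_closedBall 0 R) fun x hx ↦ ?_,
    fun x ↦ hr ⟨x, rfl⟩, fun x hx ↦ (h1 x).1 hx, fun x hx ↦ (h0 x).1 (.inl hx)⟩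
  exact (h0 x).1 (.inr fun hx' ↦ hx (Metric.ball_subset_closedBall hx'))

theorem exists_contDiff_eq_one_eq_neg_one (n : ℕ∞) {K₁ K₂ : Set V} (hK₁ : IsCompact K₁)
    (hK₂ : IsCompact K₂) (hd : Disjoint K₁ K₂) :
    ∃ g : V → ℝ, ContDiff ℝ n g ∧ HasCompactSupport g ∧ (∀ x, |g x| ≤ 1) ∧
      (∀ x ∈ K₁, g x = 1) ∧ ∀ x ∈ K₂, g x = -1 := by
  obtain ⟨g₁, hg₁, hc₁, hr₁, h₁₁, h₁₂⟩ := exists_contDiff_eq_one_eq_zero n hK₁ hK₂ hd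
  obtain ⟨g₂, hg₂, hc₂, hr₂, h₂₂, h₂₁⟩ := exists_contDiff_eq_one_eq_zero n hK₂ hK₁ hd.symm
  refine ⟨g₁ - g₂, hg₁.sub hg₂, hc₁.sub hc₂, fun x ↦ ?_, fun x hx ↦ ?_, fun x hx ↦ ?_⟩
  · exact abs_sub_le_of_nonneg_of_le (hr₁ x).1 (hr₁ x).2 (hr₂ x).1 (hr₂ x).2
  · simp [h₁₁ x hx, h₂₁ x hx]
  · simp [h₁₂ x hx, h₂₂ x hx]

variable [MeasurableSpace V] [BorelSpace V] {μ : Measure V}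

theorem measureReal_symmDiff_le_of_forall_test [μ.InnerRegularCompactLTTop]
    [IsFiniteMeasureOnCompacts μ] (n : ℕ∞) {E F : Set V} (hE : NullMeasurableSet E μ)
    (hF : NullMeasurableSet F μ) (hμE : μ E ≠ ∞) (hμF : μ F ≠ ∞) {B : ℝ}
    (h : ∀ g : V → ℝ, ContDiff ℝ n g → HasCompactSupport g → (∀ x, |g x| ≤ 1) →
      ∫ x in E, g x ∂μ - ∫ x in F, g x ∂μ ≤ B) : μ.real (E ∆ F) ≤ B := by
  refine le_of_forall_pos_le_add fun ε hε ↦ ?_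
  have hEF : μ (E \ F) ≠ ∞ := measure_ne_top_of_subset Set.sdiff_subset hμE
  have hFE : μ (F \ E) ≠ ∞ := measure_ne_top_of_subset Set.sdiff_subset hμF
  obtain ⟨K₁, hK₁, hcK₁, hlt₁⟩ :=
    exists_isCompact_measureReal_sdiff_lt (hE.diff hF) hEF (show 0 < ε / 4 by positivity)
  obtain ⟨K₂, hK₂, hcK₂, hlt₂⟩ :=
    exists_isCompact_measureReal_sdiff_lt (hF.diff hE) hFE (show 0 < ε / 4 by positivity)
  obtain ⟨g, hg, hc, hg1, hgK₁, hgK₂⟩ := exists_contDiff_eq_one_eq_neg_one n hcK₁ hcK₂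
    (disjoint_sdiff_sdiff.mono hK₁ hK₂)
  have hint : Integrable g μ := hg.continuous.integrable_of_hasCompactSupport hc
  have hE' := measureReal_sub_le_setIntegral hcK₁.measurableSet hK₁ hEF hint.integrableOn hg1 hgK₁
  have hF' := measureReal_sub_le_setIntegral hcK₂.measurableSet hK₂ hFE
    hint.neg.integrableOn (by simpa using hg1) fun x hx ↦ by simp [hgK₂ x hx]
  simp only [Pi.neg_apply, integral_neg] at hF'
  have hB := h g hg hc hg1
  rw [setIntegral_sub_setIntegral hE hF hint.integrableOn hint.integrableOn] at hB
  rw [measureReal_symmDiff_eq₀ hE hF (measure_symmDiff_ne_top hμE hμF)]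
  linarith

end Duality

section Mollification

variable {V : Type*} [NormedAddCommGroup V] [MeasurableSpace V] {μ : Measure V}

theorem integral_abs_sub_translate_le [BorelSpace V] [μ.IsAddRightInvariant] {f : V → ℝ} {K : ℝ}
    (hK : ∀ x y, |f x - f y| ≤ K * ‖x - y‖) {S : Set V} (hS : MeasurableSet S) (hμS : μ S ≠ ∞)
    (hfS : ∀ x ∉ S, f x = 0) (w : V) :
    ∫ y, |f y - f (y + w)| ∂μ ≤ 2 * K * μ.real S * ‖w‖ := by
  have hind : Integrable (S.indicator fun _ ↦ K * ‖w‖) μ :=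
    (integrable_indicator_iff hS).2 (integrableOn_const hμS)
  have hpointwise (y : V) : |f y - f (y + w)| ≤
      S.indicator (fun _ ↦ K * ‖w‖) y + S.indicator (fun _ ↦ K * ‖w‖) (y + w) := by
    have hle : |f y - f (y + w)| ≤ K * ‖w‖ := by simpa using hK y (y + w)
    have hnonneg : 0 ≤ K * ‖w‖ := (abs_nonneg _).trans hle
    by_cases hy : y ∈ S <;> by_cases hyw : y + w ∈ S <;> simp_all [le_add_of_le_of_nonneg]
  calc ∫ y, |f y - f (y + w)| ∂μ
      ≤ ∫ y, S.indicator (fun _ ↦ K * ‖w‖) y + S.indicator (fun _ ↦ K * ‖w‖) (y + w) ∂μ :=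
        integral_mono_of_nonneg (.of_forall fun _ ↦ abs_nonneg _)
          (hind.add (hind.comp_add_right w)) (.of_forall hpointwise)
    _ = 2 * K * μ.real S * ‖w‖ := by
        rw [integral_add hind (hind.comp_add_right w), integral_add_right_eq_self,
          integral_indicator_const _ hS, smul_eq_mul]
        ring

/-- A normalized mollifier supported in the unit ball, whose translates depend Lipschitz
continuously on the translation vector in the `L¹` norm, with constant `L`. -/
structure IsMollifier (μ : Measure V) (φ : V → ℝ) (L : ℝ≥0) : Prop where
  nonneg : ∀ y, 0 ≤ φ y
  integrable : Integrable φ μ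
  integral_eq_one : ∫ y, φ y ∂μ = 1
  eq_zero_of_one_lt_norm : ∀ y, 1 < ‖y‖ → φ y = 0
  integral_abs_sub_translate_le : ∀ w, ∫ y, |φ y - φ (y + w)| ∂μ ≤ L * ‖w‖

variable [NormedSpace ℝ V]

theorem exists_isMollifier [BorelSpace V] [FiniteDimensional ℝ V] [μ.IsAddHaarMeasure] :
    ∃ (φ : V → ℝ) (L : ℝ≥0), IsMollifier μ φ L := by
  let f : ContDiffBump (0 : V) := ⟨1 / 2, 1, by norm_num, by norm_num⟩
  have hsupp (y : V) (hy : y ∉ Metric.ball 0 1) : f.normed μ y = 0 := by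
    rwa [← Function.notMem_support, f.support_normed_eq]
  obtain ⟨K, hK⟩ := ContDiff.lipschitzWith_of_hasCompactSupport (𝕂 := ℝ) (n := 1)
    (f.hasCompactSupport_normed (μ := μ)) f.contDiff_normed one_ne_zero
  refine ⟨f.normed μ, ⟨2 * K * μ.real (Metric.ball 0 1), by positivity⟩, f.nonneg_normed,
    f.integrable_normed, f.integral_normed, fun y hy ↦ hsupp y (by simpa using hy.le), ?_⟩
  exact integral_abs_sub_translate_le (fun x y ↦ by simpa [dist_eq_norm] using hK.dist_le_mul x y)
    measurableSet_ball measure_ball_lt_top.ne hsupp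

/-- The average `x ↦ ∫ φ(y) g(x - r y) dy` of a function `g` at scale `r`. -/
noncomputable def mollify (μ : Measure V) (φ : V → ℝ) (r : ℝ) (g : V → ℝ) (x : V) : ℝ :=
  ∫ y, φ y * g (x - r • y) ∂μ

namespace IsMollifier

variable {φ : V → ℝ} {L : ℝ≥0} {g : V → ℝ}

theorem abs_mollify_le (hφ : IsMollifier μ φ L) (hg1 : ∀ x, |g x| ≤ 1) (r : ℝ) (x : V) :
    |mollify μ φ r g x| ≤ 1 := by
  rw [mollify, ← hφ.integral_eq_one, ← Real.norm_eq_abs]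
  refine norm_integral_le_of_norm_le hφ.integrable (.of_forall fun y ↦ ?_)
  rw [norm_mul, Real.norm_of_nonneg (hφ.nonneg y)]
  exact mul_le_of_le_one_right (hφ.nonneg y) (hg1 _)

variable [BorelSpace V]

theorem integrable_mul (hφ : IsMollifier μ φ L) (hg : Continuous g) (hg1 : ∀ x, |g x| ≤ 1) (r : ℝ)
    (x : V) : Integrable (fun y ↦ φ y * g (x - r • y)) μ :=
  hφ.integrable.mul_bdd (c := 1) (hg.comp (by fun_prop)).aestronglyMeasurable
    (.of_forall fun _ ↦ hg1 _)

theorem mollify_eq_integral_translate [μ.IsAddRightInvariant] {r : ℝ} (hr : r ≠ 0) (x x' : V) :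
    mollify μ φ r g x' = ∫ y, φ (y + r⁻¹ • (x' - x)) * g (x - r • y) ∂μ := by
  rw [mollify, ← integral_add_right_eq_self _ (r⁻¹ • (x' - x))]
  refine integral_congr_ae (.of_forall fun y ↦ ?_)
  simp only [smul_add, smul_inv_smul₀ hr]
  congr 2
  abel

theorem abs_mollify_sub_le [μ.IsAddRightInvariant] (hφ : IsMollifier μ φ L) (hg : Continuous g)
    (hg1 : ∀ x, |g x| ≤ 1) {r : ℝ} (hr : 0 < r) (x x' : V) :
    |mollify μ φ r g x - mollify μ φ r g x'| ≤ L / r * ‖x - x'‖ := by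
  set w := r⁻¹ • (x' - x) with hw
  have hint : Integrable (fun y ↦ φ (y + w) * g (x - r • y)) μ :=
    (hφ.integrable.comp_add_right w).mul_bdd (c := 1) (hg.comp (by fun_prop)).aestronglyMeasurable
      (.of_forall fun _ ↦ hg1 _)
  calc |mollify μ φ r g x - mollify μ φ r g x'|
      = ‖∫ y, (φ y - φ (y + w)) * g (x - r • y) ∂μ‖ := by
        rw [mollify_eq_integral_translate hr.ne' x x', mollify,
          ← integral_sub (hφ.integrable_mul hg hg1 r x) hint, Real.norm_eq_abs]
        simp only [sub_mul, hw]
    _ ≤ ∫ y, |φ y - φ (y + w)| ∂μ := by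
        refine norm_integral_le_of_norm_le
          (hφ.integrable.sub (hφ.integrable.comp_add_right w)).abs (.of_forall fun y ↦ ?_)
        rw [norm_mul]
        exact mul_le_of_le_one_right (abs_nonneg _) (hg1 _)
    _ ≤ L * ‖w‖ := hφ.integral_abs_sub_translate_le w
    _ = L / r * ‖x - x'‖ := by
        rw [hw, norm_smul, norm_inv, Real.norm_of_nonneg hr.le, norm_sub_rev]
        ring

theorem setIntegral_mollify [SecondCountableTopology V] [SFinite μ] (hφ : IsMollifier μ φ L)
    (hg : Continuous g) (hg1 : ∀ x, |g x| ≤ 1) (r : ℝ) (ν : Measure V) [IsFiniteMeasure ν] :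
    Integrable (fun y ↦ φ y * ∫ x, g (x - r • y) ∂ν) μ ∧
      ∫ x, mollify μ φ r g x ∂ν = ∫ y, φ y * ∫ x, g (x - r • y) ∂ν ∂μ := by
  have hprod : Integrable (Function.uncurry fun x y ↦ φ y * g (x - r • y)) (ν.prod μ) :=
    (hφ.integrable.comp_snd ν).mul_bdd (c := 1) (hg.comp (by fun_prop)).aestronglyMeasurable
      (.of_forall fun _ ↦ hg1 _)
  constructor
  · simpa only [Function.uncurry, integral_const_mul] using hprod.integral_prod_right
  · simp only [mollify, integral_integral_swap hprod, integral_const_mul]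

variable {d : ℕ} {φ g : EuclideanSpace ℝ (Fin d) → ℝ}

theorem abs_setIntegral_sub_mollify_le (hφ : IsMollifier volume φ L)
    {A : Set (EuclideanSpace ℝ (Fin d))} (hA : perimeter A ≠ ∞) (hvol : volume A ≠ ∞)
    (hg : ContDiff ℝ 1 g) (hc : HasCompactSupport g) (hg1 : ∀ x, |g x| ≤ 1) {r : ℝ} (hr : 0 < r) :
    |(∫ x in A, g x) - ∫ x in A, mollify volume φ r g x| ≤ r * (perimeter A).toReal := by
  have : IsFiniteMeasure (volume.restrict A) := isFiniteMeasure_restrict.2 hvol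
  have average_const (c : ℝ) : ∫ y, φ y * c = c := by
    rw [integral_mul_const, hφ.integral_eq_one, one_mul]
  obtain ⟨hint, hmoll⟩ := hφ.setIntegral_mollify hg.continuous hg1 r (volume.restrict A)
  rw [hmoll, ← average_const (∫ x in A, g x), ← average_const (r * _),
    ← integral_sub (hφ.integrable.mul_const _) hint, ← Real.norm_eq_abs]
  refine norm_integral_le_of_norm_le (hφ.integrable.mul_const _) (.of_forall fun y ↦ ?_)
  rw [← mul_sub, norm_mul, Real.norm_of_nonneg (hφ.nonneg y)]
  rcases le_or_gt ‖y‖ 1 with hy | hy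
  · refine mul_le_mul_of_nonneg_left ?_ (hφ.nonneg y)
    refine (abs_setIntegral_sub_translate_le hA hvol hg hc hg1 (r • y)).trans ?_
    rw [norm_smul, Real.norm_of_nonneg hr.le]
    gcongr
    exact mul_le_of_le_one_right hr.le hy
  · simp [hφ.eq_zero_of_one_lt_norm y hy]

theorem measureReal_symmDiff_le (hφ : IsMollifier volume φ L)
    {E F : Set (EuclideanSpace ℝ (Fin d))} (hE : NullMeasurableSet E) (hF : NullMeasurableSet F)
    (hvE : volume E ≠ ∞) (hvF : volume F ≠ ∞) (hPE : perimeter E ≠ ∞) (hPF : perimeter F ≠ ∞)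
    {r B : ℝ} (hr : 0 < r)
    (h : ∀ G : EuclideanSpace ℝ (Fin d) → ℝ, (∀ x, |G x| ≤ 1) →
      (∀ x x', |G x - G x'| ≤ L / r * ‖x - x'‖) → (∫ x in E, G x) - ∫ x in F, G x ≤ B) :
    volume.real (E ∆ F) ≤ r * ((perimeter E).toReal + (perimeter F).toReal) + B := by
  refine measureReal_symmDiff_le_of_forall_test 1 hE hF hvE hvF fun g hg hc hg1 ↦ ?_
  have hmE := abs_le.1 (hφ.abs_setIntegral_sub_mollify_le hPE hvE hg hc hg1 hr)
  have hmF := abs_le.1 (hφ.abs_setIntegral_sub_mollify_le hPF hvF hg hc hg1 hr)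
  have hG := h _ (hφ.abs_mollify_le hg1 r) (hφ.abs_mollify_sub_le hg.continuous hg1 hr)
  linarith [hmE.2, hmF.1]

end IsMollifier

end Mollification

section Coupling

theorem add_sq_le_two_mul (a b : ℝ≥0∞) : (a + b) ^ 2 ≤ 2 * (a ^ 2 + b ^ 2) := by
  have := ENNReal.rpow_add_le_mul_rpow_add_rpow a b one_le_two
  norm_num at this
  exact this

variable {X Y Z : Type*} [MeasurableSpace X] [MeasurableSpace Y] [MeasurableSpace Z]
  {μ : Measure X} {ν : Measure Y} {ρ : Measure Z} {γ : Measure (X × Y)}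

/-- A coupling of two finite measures: a finite measure on the product with these marginals. -/
structure IsCoupling (μ : Measure X) (ν : Measure Y) (γ : Measure (X × Y)) : Prop where
  isFiniteMeasure : IsFiniteMeasure γ
  fst_eq : γ.fst = μ
  snd_eq : γ.snd = ν

theorem isCoupling_diag [IsFiniteMeasure μ] : IsCoupling μ μ (μ.map fun x ↦ (x, x)) where
  isFiniteMeasure := inferInstance
  fst_eq := (Measure.fst_map_prodMk measurable_id).trans Measure.map_id
  snd_eq := (Measure.snd_map_prodMk measurable_id).trans Measure.map_id

theorem isCoupling_inv_smul_prod [IsFiniteMeasure μ] [IsFiniteMeasure ν]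
    (h : μ Set.univ = ν Set.univ) : IsCoupling μ ν ((μ Set.univ)⁻¹ • μ.prod ν) := by
  rcases eq_or_ne μ 0 with rfl | hμ
  · obtain rfl : ν = 0 := Measure.measure_univ_eq_zero.1 (by simpa using h.symm)
    simpa using (⟨inferInstance, Measure.fst_zero, Measure.snd_zero⟩ : IsCoupling 0 0 0)
  have hmass : μ Set.univ ≠ 0 := Measure.measure_univ_ne_zero.2 hμ
  have hinv : (μ Set.univ)⁻¹ * μ Set.univ = 1 := ENNReal.inv_mul_cancel hmass (measure_ne_top _ _)
  refine ⟨Measure.smul_finite _ (ENNReal.inv_ne_top.2 hmass), ?_, ?_⟩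
  · rw [Measure.fst, Measure.map_smul, Measure.map_fst_prod, smul_smul, ← h, hinv, one_smul]
  · rw [Measure.snd, Measure.map_smul, Measure.map_snd_prod, smul_smul, hinv, one_smul]

namespace IsCoupling

theorem add {μ' : Measure X} {ν' : Measure Y} {γ' : Measure (X × Y)} (hγ : IsCoupling μ ν γ)
    (hγ' : IsCoupling μ' ν' γ') : IsCoupling (μ + μ') (ν + ν') (γ + γ') := by
  have := hγ.isFiniteMeasure
  have := hγ'.isFiniteMeasure
  exact ⟨inferInstance, by rw [Measure.fst_add, hγ.fst_eq, hγ'.fst_eq],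
    by rw [Measure.snd_add, hγ.snd_eq, hγ'.snd_eq]⟩

theorem measure_univ_left (hγ : IsCoupling μ ν γ) : μ Set.univ = γ Set.univ := by
  rw [← hγ.fst_eq, Measure.fst_univ]

theorem measure_univ_right (hγ : IsCoupling μ ν γ) : ν Set.univ = γ Set.univ := by
  rw [← hγ.snd_eq, Measure.snd_univ]

theorem lintegral_fst (hγ : IsCoupling μ ν γ) {f : X → ℝ≥0∞} (hf : Measurable f) :
    ∫⁻ p, f p.1 ∂γ = ∫⁻ x, f x ∂μ := by
  rw [← hγ.fst_eq, Measure.fst, lintegral_map hf measurable_fst]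

theorem lintegral_snd (hγ : IsCoupling μ ν γ) {f : Y → ℝ≥0∞} (hf : Measurable f) :
    ∫⁻ p, f p.2 ∂γ = ∫⁻ y, f y ∂ν := by
  rw [← hγ.snd_eq, Measure.snd, lintegral_map hf measurable_snd]

theorem exists_glue [StandardBorelSpace Z] [Nonempty Z] {γ' : Measure (Y × Z)}
    (hγ : IsCoupling μ ν γ) (hγ' : IsCoupling ν ρ γ') :
    ∃ η : Measure ((X × Y) × Z), IsFiniteMeasure η ∧ η.map Prod.fst = γ ∧
      η.map (fun p ↦ (p.1.2, p.2)) = γ' := by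
  have := hγ.isFiniteMeasure
  have := hγ'.isFiniteMeasure
  refine ⟨γ.compProd (γ'.condKernel.comap Prod.snd measurable_snd), inferInstance,
    Measure.fst_compProd _ _, Measure.ext_of_lintegral _ fun f hf ↦ ?_⟩
  rw [lintegral_map hf (by fun_prop), Measure.lintegral_compProd (by fun_prop)]
  conv_rhs => rw [← γ'.disintegrate γ'.condKernel, hγ'.fst_eq, ← hγ.snd_eq]
  rw [Measure.lintegral_compProd hf, Measure.snd, lintegral_map hf.lintegral_kernel_prod_right'
    measurable_snd]
  rfl

theorem fst_restrict_prod_le (hγ : IsCoupling μ ν γ) {E : Set X} (hE : MeasurableSet E)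
    (F : Set Y) : (γ.restrict (E ×ˢ F)).fst ≤ μ.restrict E := by
  rw [← hγ.fst_eq, Measure.fst, Measure.fst, Measure.restrict_map measurable_fst hE]
  exact Measure.map_mono (Measure.restrict_mono_set γ fun _ hp ↦ hp.1) measurable_fst

theorem snd_restrict_prod_le (hγ : IsCoupling μ ν γ) (E : Set X) {F : Set Y}
    (hF : MeasurableSet F) : (γ.restrict (E ×ˢ F)).snd ≤ ν.restrict F := by
  rw [← hγ.snd_eq, Measure.snd, Measure.snd, Measure.restrict_map measurable_snd hF]
  exact Measure.map_mono (Measure.restrict_mono_set γ fun _ hp ↦ hp.2) measurable_snd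

theorem measure_compl_prod_le (hγ : IsCoupling μ ν γ) {E : Set X} {F : Set Y}
    (hE : MeasurableSet E) (hF : MeasurableSet F) : γ (E ×ˢ F)ᶜ ≤ μ Eᶜ + ν Fᶜ := by
  rw [← hγ.fst_eq, ← hγ.snd_eq, Measure.fst_apply hE.compl, Measure.snd_apply hF.compl]
  refine (measure_mono fun p hp ↦ ?_).trans (measure_union_le _ _)
  simpa [or_iff_not_imp_left] using hp

end IsCoupling

end Coupling

section Wasserstein

variable {X : Type*} [PseudoEMetricSpace X] [MeasurableSpace X] {μ ν ρ : Measure X}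
  {γ : Measure (X × X)}

/-- The squared `2`-Wasserstein distance of two finite measures; it is `∞` if their masses are
different. -/
noncomputable def wassersteinSq (μ ν : Measure X) : ℝ≥0∞ :=
  ⨅ (γ : Measure (X × X)) (_ : IsCoupling μ ν γ), ∫⁻ p, edist p.1 p.2 ^ 2 ∂γ

/-- The `2`-Wasserstein distance of two finite measures. -/
noncomputable def wasserstein (μ ν : Measure X) : ℝ≥0∞ :=
  wassersteinSq μ ν ^ (1 / 2 : ℝ)

theorem IsCoupling.wassersteinSq_le (hγ : IsCoupling μ ν γ) :
    wassersteinSq μ ν ≤ ∫⁻ p, edist p.1 p.2 ^ 2 ∂γ :=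
  iInf₂_le γ hγ

theorem exists_isCoupling_of_wassersteinSq_lt {a : ℝ≥0∞} (h : wassersteinSq μ ν < a) :
    ∃ γ, IsCoupling μ ν γ ∧ ∫⁻ p, edist p.1 p.2 ^ 2 ∂γ < a := by
  simpa only [wassersteinSq, iInf_lt_iff, exists_prop] using h

theorem wassersteinSq_eq_iInf : wassersteinSq μ ν =
    ⨅ γ : {γ : Measure (X × X) // IsCoupling μ ν γ}, ∫⁻ p, edist p.1 p.2 ^ 2 ∂γ.1 :=
  iInf_subtype'

theorem wasserstein_eq_iInf : wasserstein μ ν =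
    ⨅ γ : {γ : Measure (X × X) // IsCoupling μ ν γ},
      (∫⁻ p, edist p.1 p.2 ^ 2 ∂γ.1) ^ (1 / 2 : ℝ) := by
  rw [wasserstein, wassersteinSq_eq_iInf]
  exact (ENNReal.orderIsoRpow (1 / 2) one_half_pos).map_iInf _

theorem measure_univ_eq_of_wassersteinSq_ne_top (h : wassersteinSq μ ν ≠ ∞) :
    μ Set.univ = ν Set.univ := by
  obtain ⟨γ, hγ, -⟩ := exists_isCoupling_of_wassersteinSq_lt h.lt_top
  rw [hγ.measure_univ_left, hγ.measure_univ_right]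

variable [OpensMeasurableSpace X] [SecondCountableTopology X]

theorem wassersteinSq_self [IsFiniteMeasure μ] : wassersteinSq μ μ = 0 := by
  refine le_antisymm (isCoupling_diag.wassersteinSq_le.trans_eq ?_) zero_le
  rw [lintegral_map (by fun_prop) (by fun_prop)]
  simp

theorem wasserstein_triangle [StandardBorelSpace X] [Nonempty X] :
    wasserstein μ ρ ≤ wasserstein μ ν + wasserstein ν ρ := by
  simp only [wasserstein_eq_iInf, ENNReal.iInf_add, ENNReal.add_iInf]
  refine le_iInf fun ⟨γ', hγ'⟩ ↦ le_iInf fun ⟨γ, hγ⟩ ↦ ?_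
  obtain ⟨η, hη, hη₁, hη₂⟩ := hγ.exists_glue hγ'
  have hcoupling : IsCoupling μ ρ (η.map fun p ↦ (p.1.1, p.2)) := by
    refine ⟨inferInstance, ?_, ?_⟩
    · rw [Measure.fst_map_prodMk measurable_snd, ← hγ.fst_eq, ← hη₁, Measure.fst,
        Measure.map_map measurable_fst measurable_fst]
      rfl
    · rw [Measure.snd_map_prodMk (by fun_prop), ← hγ'.snd_eq, ← hη₂,
        Measure.snd_map_prodMk (by fun_prop)]
  refine (iInf_le _ ⟨_, hcoupling⟩).trans ?_
  dsimp only
  rw [← hη₁, ← hη₂]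
  rw [lintegral_map (by fun_prop) (by fun_prop), lintegral_map (by fun_prop) (by fun_prop),
    lintegral_map (by fun_prop) (by fun_prop)]
  have minkowski := ENNReal.lintegral_Lp_add_le (μ := η) (p := 2)
    (f := fun p ↦ edist p.1.1 p.1.2) (g := fun p ↦ edist p.1.2 p.2)
    (by fun_prop) (by fun_prop) one_le_two
  simp only [ENNReal.rpow_two, Pi.add_apply] at minkowski
  refine le_trans ?_ minkowski
  gcongr
  exact edist_triangle _ _ _

theorem lintegral_edist_sq_le (a : X) :
    ∫⁻ x, edist x a ^ 2 ∂μ ≤ 2 * ∫⁻ x, edist x a ^ 2 ∂ν + 2 * wassersteinSq μ ν := by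
  rw [wassersteinSq_eq_iInf, ENNReal.mul_iInf_of_ne two_ne_zero ENNReal.ofNat_ne_top,
    ENNReal.add_iInf]
  refine le_iInf fun ⟨γ, hγ⟩ ↦ ?_
  rw [← hγ.lintegral_fst (by fun_prop), ← hγ.lintegral_snd (by fun_prop), ← mul_add,
    ← lintegral_add_left (by fun_prop), ← lintegral_const_mul _ (by fun_prop)]
  refine lintegral_mono fun p ↦ ?_
  calc edist p.1 a ^ 2 ≤ (edist p.2 a + edist p.1 p.2) ^ 2 := by
        gcongr
        exact (edist_triangle _ p.2 _).trans_eq (add_comm _ _)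
    _ ≤ 2 * (edist p.2 a ^ 2 + edist p.1 p.2 ^ 2) := add_sq_le_two_mul _ _

theorem IsCoupling.ofReal_integral_sub_integral_le (hγ : IsCoupling μ ν γ) {K : ℝ≥0} {g : X → ℝ}
    (hg : LipschitzWith K g) (hgμ : Integrable g μ) (hgν : Integrable g ν) :
    ENNReal.ofReal (∫ x, g x ∂μ - ∫ x, g x ∂ν) ≤
      K * μ Set.univ ^ (1 / 2 : ℝ) * (∫⁻ p, edist p.1 p.2 ^ 2 ∂γ) ^ (1 / 2 : ℝ) := by
  have hmeas (m : Measure X) : AEStronglyMeasurable g m := hg.continuous.aestronglyMeasurable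
  have hint₁ : Integrable (fun p ↦ g p.1) γ :=
    (integrable_map_measure (hmeas _) measurable_fst.aemeasurable).1
      (by rwa [← hγ.fst_eq] at hgμ)
  have hint₂ : Integrable (fun p ↦ g p.2) γ :=
    (integrable_map_measure (hmeas _) measurable_snd.aemeasurable).1
      (by rwa [← hγ.snd_eq] at hgν)
  calc ENNReal.ofReal (∫ x, g x ∂μ - ∫ x, g x ∂ν)
      = ENNReal.ofReal (∫ p, (g p.1 - g p.2) ∂γ) := by
        rw [integral_sub hint₁ hint₂, ← hγ.fst_eq, ← hγ.snd_eq, Measure.fst, Measure.snd,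
          integral_map measurable_fst.aemeasurable (hmeas _),
          integral_map measurable_snd.aemeasurable (hmeas _)]
    _ ≤ ∫⁻ p, ‖g p.1 - g p.2‖ₑ ∂γ :=
        (Real.ofReal_le_enorm _).trans (enorm_integral_le_lintegral_enorm _)
    _ ≤ ∫⁻ p, K * (1 * edist p.1 p.2) ∂γ := by
        refine lintegral_mono fun p ↦ ?_
        rw [one_mul, ← edist_eq_enorm_sub]
        exact hg p.1 p.2
    _ = K * ∫⁻ p, 1 * edist p.1 p.2 ∂γ := lintegral_const_mul _ (by fun_prop)
    _ ≤ K * (μ Set.univ ^ (1 / 2 : ℝ) * (∫⁻ p, edist p.1 p.2 ^ 2 ∂γ) ^ (1 / 2 : ℝ)) := by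
        gcongr
        simpa [hγ.measure_univ_left] using
          ENNReal.lintegral_mul_le_Lp_mul_Lq γ Real.HolderConjugate.two_two (f := fun _ ↦ 1)
            (g := fun p ↦ edist p.1 p.2) (by fun_prop) (by fun_prop)
    _ = _ := (mul_assoc _ _ _).symm

theorem ofReal_integral_sub_integral_le [IsFiniteMeasure μ] {K : ℝ≥0} {g : X → ℝ}
    (hg : LipschitzWith K g) (hgμ : Integrable g μ) (hgν : Integrable g ν)
    (hW : wasserstein μ ν ≠ ∞) :
    ENNReal.ofReal (∫ x, g x ∂μ - ∫ x, g x ∂ν) ≤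
      K * μ Set.univ ^ (1 / 2 : ℝ) * wasserstein μ ν := by
  have hnonempty : Nonempty {γ // IsCoupling μ ν γ} := by
    by_contra hempty
    rw [not_nonempty_iff] at hempty
    exact hW (by rw [wasserstein_eq_iInf, iInf_of_empty])
  have hconst : K * μ Set.univ ^ (1 / 2 : ℝ) ≠ ∞ := by finiteness
  rw [wasserstein_eq_iInf, ENNReal.mul_iInf (fun h ↦ (hconst h).elim)]
  exact le_iInf fun γ ↦ γ.2.ofReal_integral_sub_integral_le hg hgμ hgν

end Wasserstein

section WassersteinLowerSemicontinuity

theorem exists_pos_forall_lintegral_le {X : Type*} [MeasurableSpace X] {μ : Measure X}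
    {f : X → ℝ≥0∞} (hf : Measurable f) (hfin : ∫⁻ x, f x ∂μ ≠ ∞) {ε : ℝ≥0∞} (hε : 0 < ε) :
    ∃ δ > 0, ∀ ρ ≤ μ, ρ Set.univ ≤ δ → ∫⁻ x, f x ∂ρ ≤ ε := by
  have htail : Tendsto (fun n : ℕ ↦ ∫⁻ x, (f x - n) ∂μ) atTop (𝓝 (∫⁻ _, 0 ∂μ)) := by
    refine tendsto_lintegral_of_dominated_convergence f (fun n ↦ by fun_prop)
      (fun n ↦ .of_forall fun x ↦ tsub_le_self) hfin ?_
    filter_upwards [ae_lt_top hf hfin] with x hx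
    obtain ⟨N, hN⟩ := ENNReal.exists_nat_gt hx.ne
    refine tendsto_const_nhds.congr' ?_
    filter_upwards [eventually_ge_atTop N] with n hn
    exact (tsub_eq_zero_of_le (hN.le.trans (by exact_mod_cast hn))).symm
  rw [lintegral_zero] at htail
  obtain ⟨n, hn⟩ := (htail.eventually_le_const (ENNReal.half_pos hε.ne')).exists
  refine ⟨ε / 2 / n, ENNReal.div_pos (ENNReal.half_pos hε.ne').ne' (ENNReal.natCast_ne_top n),
    fun ρ hρ hρδ ↦ ?_⟩
  calc ∫⁻ x, f x ∂ρ ≤ ∫⁻ x, (f x - n) + n ∂ρ := lintegral_mono fun x ↦ le_tsub_add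
    _ = ∫⁻ x, (f x - n) ∂ρ + n * ρ Set.univ := by
        rw [lintegral_add_right _ measurable_const, lintegral_const]
    _ ≤ ∫⁻ x, (f x - n) ∂μ + n * (ε / 2 / n) := by gcongr
    _ ≤ ε / 2 + ε / 2 := add_le_add hn ENNReal.mul_div_le
    _ = ε := ENNReal.add_halves ε

variable {X : Type*} [PseudoEMetricSpace X] [MeasurableSpace X] {μ μ' ν ν' : Measure X}
  {γ : Measure (X × X)}

theorem wassersteinSq_add_le :
    wassersteinSq (μ + μ') (ν + ν') ≤ wassersteinSq μ ν + wassersteinSq μ' ν' := by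
  simp only [wassersteinSq_eq_iInf (μ := μ), wassersteinSq_eq_iInf (μ := μ'), ENNReal.iInf_add,
    ENNReal.add_iInf]
  refine le_iInf fun ⟨γ', hγ'⟩ ↦ le_iInf fun ⟨γ, hγ⟩ ↦ ?_
  exact (hγ.add hγ').wassersteinSq_le.trans_eq (lintegral_add_measure _ _ _)

variable [OpensMeasurableSpace X]

theorem wassersteinSq_le_lintegral_edist_sq [IsFiniteMeasure μ] [IsFiniteMeasure ν]
    (h : μ Set.univ = ν Set.univ) (a : X) :
    wassersteinSq μ ν ≤ 2 * (∫⁻ x, edist x a ^ 2 ∂μ + ∫⁻ x, edist x a ^ 2 ∂ν) := by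
  have hγ := isCoupling_inv_smul_prod h
  calc wassersteinSq μ ν ≤ ∫⁻ p, edist p.1 p.2 ^ 2 ∂((μ Set.univ)⁻¹ • μ.prod ν) :=
        hγ.wassersteinSq_le
    _ ≤ ∫⁻ p, 2 * (edist p.1 a ^ 2 + edist p.2 a ^ 2) ∂((μ Set.univ)⁻¹ • μ.prod ν) :=
        lintegral_mono fun p ↦
          (pow_le_pow_left' (edist_triangle_right p.1 p.2 a) 2).trans (add_sq_le_two_mul _ _)
    _ = _ := by
        rw [lintegral_const_mul _ (by fun_prop), lintegral_add_left (by fun_prop),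
          hγ.lintegral_fst (f := fun x ↦ edist x a ^ 2) (by fun_prop),
          hγ.lintegral_snd (f := fun x ↦ edist x a ^ 2) (by fun_prop)]

/-- A coupling of parts of `μ` and `ν` is completed by the product coupling of the rest. -/
theorem wassersteinSq_le_of_fst_le_of_snd_le [IsFiniteMeasure μ] [IsFiniteMeasure ν]
    [IsFiniteMeasure γ] (h : μ Set.univ = ν Set.univ) (hμ : γ.fst ≤ μ) (hν : γ.snd ≤ ν) (a : X) :
    wassersteinSq μ ν ≤ ∫⁻ p, edist p.1 p.2 ^ 2 ∂γ +
      2 * (∫⁻ x, edist x a ^ 2 ∂(μ - γ.fst) + ∫⁻ x, edist x a ^ 2 ∂(ν - γ.snd)) := by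
  have hrest : (μ - γ.fst) Set.univ = (ν - γ.snd) Set.univ := by
    rw [Measure.sub_apply .univ hμ, Measure.sub_apply .univ hν, h, Measure.fst_univ,
      Measure.snd_univ]
  have hγ : IsCoupling γ.fst γ.snd γ := ⟨inferInstance, rfl, rfl⟩
  calc wassersteinSq μ ν
      = wassersteinSq (γ.fst + (μ - γ.fst)) (γ.snd + (ν - γ.snd)) := by
        rw [add_comm γ.fst, add_comm γ.snd, Measure.sub_add_cancel_of_le hμ,
          Measure.sub_add_cancel_of_le hν]
    _ ≤ wassersteinSq γ.fst γ.snd + wassersteinSq (μ - γ.fst) (ν - γ.snd) := wassersteinSq_add_le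
    _ ≤ _ := add_le_add hγ.wassersteinSq_le (wassersteinSq_le_lintegral_edist_sq hrest a)

theorem IsCoupling.exists_wassersteinSq_restrict_le {m : Measure X} {A B E F : Set X}
    (hγ : IsCoupling (m.restrict A) (m.restrict B) γ) (hE : MeasurableSet E) (hF : MeasurableSet F)
    (hmE : m A = m E) (hmF : m B = m F) (a : X) :
    ∃ ρ ≤ m.restrict E, ∃ σ ≤ m.restrict F, ρ Set.univ ≤ m (A ∆ E) + m (B ∆ F) ∧
      σ Set.univ ≤ m (A ∆ E) + m (B ∆ F) ∧
      wassersteinSq (m.restrict E) (m.restrict F) ≤ ∫⁻ p, edist p.1 p.2 ^ 2 ∂γ +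
        2 * (∫⁻ x, edist x a ^ 2 ∂ρ + ∫⁻ x, edist x a ^ 2 ∂σ) := by
  have := hγ.isFiniteMeasure
  have hmassE : m.restrict E Set.univ = γ Set.univ := by simpa [hmE] using hγ.measure_univ_left
  have hmassF : m.restrict F Set.univ = γ Set.univ := by simpa [hmF] using hγ.measure_univ_right
  have : IsFiniteMeasure (m.restrict E) := ⟨hmassE ▸ measure_lt_top γ _⟩
  have : IsFiniteMeasure (m.restrict F) := ⟨hmassF ▸ measure_lt_top γ _⟩
  have hfst : (γ.restrict (E ×ˢ F)).fst ≤ m.restrict E :=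
    (hγ.fst_restrict_prod_le hE F).trans (Measure.restrict_mono subset_rfl Measure.restrict_le_self)
  have hsnd : (γ.restrict (E ×ˢ F)).snd ≤ m.restrict F :=
    (hγ.snd_restrict_prod_le E hF).trans (Measure.restrict_mono subset_rfl Measure.restrict_le_self)
  have hrest : γ Set.univ - γ (E ×ˢ F) ≤ m (A ∆ E) + m (B ∆ F) := by
    rw [← measure_compl (hE.prod hF) (measure_ne_top _ _)]
    exact (hγ.measure_compl_prod_le hE hF).trans
      (add_le_add (restrict_compl_le_measure_symmDiff hE) (restrict_compl_le_measure_symmDiff hF))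
  refine ⟨m.restrict E - _, Measure.sub_le, m.restrict F - _, Measure.sub_le, ?_, ?_,
    (wassersteinSq_le_of_fst_le_of_snd_le (hmassE.trans hmassF.symm) hfst hsnd a).trans
      (add_le_add_left (setLIntegral_le_lintegral _ _) _)⟩
  · rwa [Measure.sub_apply .univ hfst, hmassE, Measure.fst_univ, Measure.restrict_apply_univ]
  · rwa [Measure.sub_apply .univ hsnd, hmassF, Measure.snd_univ, Measure.restrict_apply_univ]

theorem exists_pos_forall_wassersteinSq_restrict_le {m : Measure X} {E F : Set X}
    (hE : MeasurableSet E) (hF : MeasurableSet F) {a : X}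
    (hmE : ∫⁻ x in E, edist x a ^ 2 ∂m ≠ ∞) (hmF : ∫⁻ x in F, edist x a ^ 2 ∂m ≠ ∞) {ε : ℝ≥0∞}
    (hε : 0 < ε) :
    ∃ δ > 0, ∀ A B : Set X, m A = m E → m B = m F → m (A ∆ E) + m (B ∆ F) ≤ δ →
      wassersteinSq (m.restrict E) (m.restrict F) ≤
        wassersteinSq (m.restrict A) (m.restrict B) + ε := by
  have hε4 : 0 < ε / 4 := ENNReal.div_pos hε.ne' (by simp)
  obtain ⟨δ₁, hδ₁, h₁⟩ := exists_pos_forall_lintegral_le (by fun_prop) hmE hε4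
  obtain ⟨δ₂, hδ₂, h₂⟩ := exists_pos_forall_lintegral_le (by fun_prop) hmF hε4
  refine ⟨min δ₁ δ₂, lt_min hδ₁ hδ₂, fun A B hA hB hδ ↦ ?_⟩
  rw [wassersteinSq_eq_iInf (μ := m.restrict A), ENNReal.iInf_add]
  refine le_iInf fun ⟨γ, hγ⟩ ↦ ?_
  obtain ⟨ρ, hρE, σ, hσF, hρ, hσ, hW⟩ := hγ.exists_wassersteinSq_restrict_le hE hF hA hB a
  refine hW.trans (add_le_add_right ?_ _)
  calc 2 * (∫⁻ x, edist x a ^ 2 ∂ρ + ∫⁻ x, edist x a ^ 2 ∂σ) ≤ 2 * (ε / 4 + ε / 4) := by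
        gcongr
        · exact h₁ ρ hρE (hρ.trans (hδ.trans (min_le_left _ _)))
        · exact h₂ σ hσF (hσ.trans (hδ.trans (min_le_right _ _)))
    _ = 4 * (ε / 4) := by ring
    _ = ε := ENNReal.mul_div_cancel (by simp) (by simp)

theorem wassersteinSq_restrict_le_of_tendsto {ι : Type*} {l : Filter ι} [l.NeBot] {m : Measure X}
    {E F : Set X} (hE : MeasurableSet E) (hF : MeasurableSet F) {a : X}
    (hmE : ∫⁻ x in E, edist x a ^ 2 ∂m ≠ ∞) (hmF : ∫⁻ x in F, edist x a ^ 2 ∂m ≠ ∞)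
    {A B : ι → Set X} (hmA : ∀ i, m (A i) = m E) (hmB : ∀ i, m (B i) = m F)
    (hAE : Tendsto (fun i ↦ m (A i ∆ E)) l (𝓝 0)) (hBF : Tendsto (fun i ↦ m (B i ∆ F)) l (𝓝 0))
    {w : ι → ℝ≥0∞} {w₀ : ℝ≥0∞} (hw : Tendsto w l (𝓝 w₀))
    (hle : ∀ᶠ i in l, wassersteinSq (m.restrict (A i)) (m.restrict (B i)) ≤ w i) :
    wassersteinSq (m.restrict E) (m.restrict F) ≤ w₀ := by
  refine ENNReal.le_of_forall_pos_le_add fun ε hε _ ↦ ?_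
  obtain ⟨δ, hδ, h⟩ := exists_pos_forall_wassersteinSq_restrict_le hE hF hmE hmF
    (ENNReal.coe_pos.2 hε)
  have hsum : Tendsto (fun i ↦ m (A i ∆ E) + m (B i ∆ F)) l (𝓝 0) := by simpa using hAE.add hBF
  refine ge_of_tendsto (hw.add_const (ε : ℝ≥0∞)) ?_
  filter_upwards [hle, hsum.eventually_le_const hδ] with i hi hclose
  exact (h _ _ (hmA i) (hmB i) hclose).trans (add_le_add_left hi _)

end WassersteinLowerSemicontinuity

section Interpolation

theorem sq_le_four_mul_of_forall_le {x a b : ℝ} (hx : 0 ≤ x) (ha : 0 ≤ a) (hb : 0 ≤ b)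
    (h : ∀ r > 0, x ≤ r * a + b / r) : x ^ 2 ≤ 4 * a * b := by
  have hdiscrim : discrim a (-x) b ≤ 0 := by
    refine discrim_le_zero fun r ↦ ?_
    rcases le_or_gt r 0 with hr | hr
    · nlinarith [mul_nonneg ha (mul_self_nonneg r),
        mul_nonneg_of_nonpos_of_nonpos (neg_nonpos.2 hx) hr]
    · have := mul_le_mul_of_nonneg_right (h r hr) hr.le
      rw [add_mul, div_mul_cancel₀ _ hr.ne'] at this
      linarith
  rw [discrim] at hdiscrim
  linarith

variable {d : ℕ} {E F : Set (EuclideanSpace ℝ (Fin d))}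

theorem W2sq_eq_wassersteinSq :
    W2sq E F = wassersteinSq (volume.restrict E) (volume.restrict F) := by
  simp only [W2sq, wassersteinSq, edist_eq_enorm_sub]
  exact iInf_congr fun γ ↦ iInf_congr_Prop
    ⟨fun ⟨hfin, hfst, hsnd⟩ ↦ ⟨hfin, hfst, hsnd⟩, fun ⟨hfin, hfst, hsnd⟩ ↦ ⟨hfin, hfst, hsnd⟩⟩
    fun _ ↦ rfl

theorem W2_eq_wasserstein : W2 E F = wasserstein (volume.restrict E) (volume.restrict F) := by
  rw [W2, wasserstein, W2sq_eq_wassersteinSq]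

theorem volume_eq_of_W2sq_ne_top (h : W2sq E F ≠ ∞) : volume E = volume F := by
  rw [W2sq_eq_wassersteinSq] at h
  simpa using measure_univ_eq_of_wassersteinSq_ne_top h

theorem W2sq_self (hE : volume E ≠ ∞) : W2sq E E = 0 := by
  have : IsFiniteMeasure (volume.restrict E) := isFiniteMeasure_restrict.2 hE
  rw [W2sq_eq_wassersteinSq, wassersteinSq_self]

theorem IsMollifier.measureReal_symmDiff_sq_le {φ : EuclideanSpace ℝ (Fin d) → ℝ} {L : ℝ≥0}
    (hφ : IsMollifier volume φ L) (hE : NullMeasurableSet E) (hF : NullMeasurableSet F)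
    (hvE : volume E ≠ ∞) (hvF : volume F ≠ ∞) (hPE : perimeter E ≠ ∞) (hPF : perimeter F ≠ ∞)
    (hW : W2 E F ≠ ∞) :
    volume.real (E ∆ F) ^ 2 ≤ 4 * ((perimeter E).toReal + (perimeter F).toReal) *
      (L * (volume E ^ (1 / 2 : ℝ) * W2 E F).toReal) := by
  have : IsFiniteMeasure (volume.restrict E) := isFiniteMeasure_restrict.2 hvE
  have : IsFiniteMeasure (volume.restrict F) := isFiniteMeasure_restrict.2 hvF
  have hdual : volume E ^ (1 / 2 : ℝ) * W2 E F ≠ ∞ := by finiteness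
  refine sq_le_four_mul_of_forall_le (by positivity) (by positivity) (by positivity) fun r hr ↦
    hφ.measureReal_symmDiff_le hE hF hvE hvF hPE hPF hr fun G hG1 hG ↦ ?_
  have hLip : LipschitzWith (L / r).toNNReal G := .of_dist_le' fun x y ↦ by
    rw [Real.dist_eq, dist_eq_norm]
    exact hG x y
  have hint (m : Measure (EuclideanSpace ℝ (Fin d))) [IsFiniteMeasure m] : Integrable G m :=
    .of_bound hLip.continuous.aestronglyMeasurable 1 (.of_forall hG1)
  rw [W2_eq_wasserstein] at hW
  have h := ofReal_integral_sub_integral_le hLip (hint _) (hint _) hW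
  rw [← W2_eq_wasserstein, mul_assoc, Measure.restrict_apply_univ,
    ENNReal.ofReal_le_iff_le_toReal (by finiteness), ENNReal.toReal_mul, ENNReal.coe_toReal,
    Real.coe_toNNReal _ (by positivity)] at h
  exact h.trans_eq (div_mul_eq_mul_div _ _ _)

theorem exists_volume_symmDiff_sq_le (d : ℕ) : ∃ C : ℝ≥0,
    ∀ {E F : Set (EuclideanSpace ℝ (Fin d))}, NullMeasurableSet E → NullMeasurableSet F →
      volume E ≠ ∞ → perimeter E ≠ ∞ → perimeter F ≠ ∞ → W2 E F ≠ ∞ →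
      volume (E ∆ F) ^ 2 ≤ C * (perimeter E + perimeter F) * volume E ^ (1 / 2 : ℝ) * W2 E F := by
  obtain ⟨φ, L, hφ⟩ := exists_isMollifier (μ := (volume : Measure (EuclideanSpace ℝ (Fin d))))
  refine ⟨4 * L, fun {E F} hE hF hvE hPE hPF hW ↦ ?_⟩
  have hvF : volume F ≠ ∞ := by
    rwa [← volume_eq_of_W2sq_ne_top (E := E) fun htop ↦ hW ?_]
    rw [W2, htop, ENNReal.top_rpow_of_pos (by norm_num)]
  rw [← ENNReal.toReal_le_toReal (by finiteness [measure_symmDiff_ne_top hvE hvF])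
    (by finiteness)]
  convert hφ.measureReal_symmDiff_sq_le hE hF hvE hvF hPE hPF hW using 1
  · rw [ENNReal.toReal_pow, Measure.real]
  · simp only [ENNReal.toReal_mul, ENNReal.toReal_add hPE hPF, ENNReal.coe_toReal, NNReal.coe_mul,
      NNReal.coe_ofNat]
    ring

/-- The class of Lebesgue measurable sets of volume `V` and perimeter at most `P`. With `V` and `P`
the volume and the energy of the initial set, all sets of a discrete solution and their limits
belong to it. -/
structure IsAdmissible (V P : ℝ≥0∞) (A : Set (EuclideanSpace ℝ (Fin d))) : Prop where
  measurable : NullMeasurableSet A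
  volume_eq : volume A = V
  perimeter_le : perimeter A ≤ P

theorem rpow_pow_two {a b : ℝ} (hab : a * 2 = b) (x : ℝ≥0∞) : (x ^ a) ^ 2 = x ^ b := by
  rw [← hab, ENNReal.rpow_mul, ENNReal.rpow_two]

theorem W2_le_of_W2sq_le {P : ℝ≥0∞} {τ : ℝ} (hW : W2sq E F ≤ ENNReal.ofReal (4 * τ) * P) :
    W2 E F ≤ 2 * P ^ (1 / 2 : ℝ) * ENNReal.ofReal τ ^ (1 / 2 : ℝ) := by
  rw [← (ENNReal.pow_right_strictMono two_ne_zero).le_iff_le, mul_pow, mul_pow, W2]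
  simp only [rpow_pow_two (one_div_mul_cancel two_ne_zero), ENNReal.rpow_one]
  refine hW.trans_eq ?_
  rw [ENNReal.ofReal_mul zero_le_four, ENNReal.ofReal_ofNat]
  ring

theorem exists_holder_estimate (d : ℕ) : ∃ C : ℝ, 0 < C ∧
    ∀ {V P : ℝ≥0∞} {τ : ℝ} {A B : Set (EuclideanSpace ℝ (Fin d))}, V ≠ ∞ → P ≠ ∞ →
      IsAdmissible V P A → IsAdmissible V P B → W2sq A B ≤ ENNReal.ofReal (4 * τ) * P →
      W2 A B ≤ ENNReal.ofReal C * P ^ (1 / 2 : ℝ) * ENNReal.ofReal τ ^ (1 / 2 : ℝ) ∧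
      volume (A ∆ B) ≤ ENNReal.ofReal C * V ^ (1 / 4 : ℝ) * P ^ (3 / 4 : ℝ) *
        ENNReal.ofReal τ ^ (1 / 4 : ℝ) := by
  obtain ⟨C, hC⟩ := exists_volume_symmDiff_sq_le d
  refine ⟨2 * (1 + C), by positivity, fun {V P τ A B} hV hP hA hB hW ↦ ?_⟩
  have hW2 := W2_le_of_W2sq_le hW
  have hC2 : (2 : ℝ≥0∞) ≤ ENNReal.ofReal (2 * (1 + C)) := by
    rw [← ENNReal.ofReal_ofNat]
    exact ENNReal.ofReal_le_ofReal (by linarith [C.2])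
  have hC4 : 4 * (C : ℝ≥0∞) ≤ ENNReal.ofReal (2 * (1 + C)) ^ 2 := by
    rw [← ENNReal.ofReal_pow (by positivity), ← ENNReal.ofReal_coe_nnreal, ← ENNReal.ofReal_ofNat,
      ← ENNReal.ofReal_mul (by norm_num)]
    exact ENNReal.ofReal_le_ofReal (by nlinarith [C.2])
  refine ⟨hW2.trans (by gcongr), ?_⟩
  rw [← (ENNReal.pow_right_strictMono two_ne_zero).le_iff_le]
  calc volume (A ∆ B) ^ 2
    _ ≤ C * (perimeter A + perimeter B) * volume A ^ (1 / 2 : ℝ) * W2 A B :=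
        hC hA.measurable hB.measurable (hA.volume_eq ▸ hV) (ne_top_of_le_ne_top hP hA.perimeter_le)
          (ne_top_of_le_ne_top hP hB.perimeter_le) (ne_top_of_le_ne_top (by finiteness) hW2)
    _ ≤ C * (P + P) * V ^ (1 / 2 : ℝ) *
          (2 * P ^ (1 / 2 : ℝ) * ENNReal.ofReal τ ^ (1 / 2 : ℝ)) := by
        rw [hA.volume_eq]
        gcongr
        exacts [hA.perimeter_le, hB.perimeter_le]
    _ = 4 * C * V ^ (1 / 2 : ℝ) * P ^ (1 + 1 / 2 : ℝ) * ENNReal.ofReal τ ^ (1 / 2 : ℝ) := by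
        rw [ENNReal.rpow_add_of_nonneg _ _ zero_le_one (by norm_num), ENNReal.rpow_one]
        ring
    _ ≤ (ENNReal.ofReal (2 * (1 + C)) * V ^ (1 / 4 : ℝ) * P ^ (3 / 4 : ℝ) *
          ENNReal.ofReal τ ^ (1 / 4 : ℝ)) ^ 2 := by
        simp only [mul_pow, rpow_pow_two (show (1 / 4 : ℝ) * 2 = 1 / 2 by norm_num),
          rpow_pow_two (show (3 / 4 : ℝ) * 2 = 1 + 1 / 2 by norm_num)]
        gcongr

end Interpolation

section Discrete

variable {d : ℕ} {k : EuclideanSpace ℝ (Fin d) → ℝ} {E₀ : Set (EuclideanSpace ℝ (Fin d))} {h : ℝ}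
  {E : ℕ → Set (EuclideanSpace ℝ (Fin d))}

theorem IsKernel.convIndicator_le_one (hk : IsKernel k) (A : Set (EuclideanSpace ℝ (Fin d)))
    (x : EuclideanSpace ℝ (Fin d)) : convIndicator k A x ≤ 1 :=
  calc convIndicator k A x
    _ ≤ ∫⁻ y, ENNReal.ofReal (k (x - y)) := setLIntegral_le_lintegral _ _
    _ = ∫⁻ z, ENNReal.ofReal (k z) :=
        lintegral_sub_left_eq_self (fun z ↦ ENNReal.ofReal (k z)) x
    _ = 1 := by
        rw [← ofReal_integral_eq_lintegral_ofReal hk.integrable (.of_forall hk.nonneg),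
          hk.integral_eq_one, ENNReal.ofReal_one]

theorem perimeter_le_energy (k : EuclideanSpace ℝ (Fin d) → ℝ)
    (A : Set (EuclideanSpace ℝ (Fin d))) : perimeter A ≤ energy k A :=
  le_self_add

theorem IsInitialCondition.volume_ne_top (hE₀ : IsInitialCondition E₀) : volume E₀ ≠ ∞ := by
  refine ne_top_of_le_ne_top hE₀.moment_lt_top.ne ?_
  rw [← setLIntegral_one]
  exact lintegral_mono fun x ↦ ENNReal.one_le_ofReal.2 (le_add_of_nonneg_right (sq_nonneg ‖x‖))

theorem IsInitialCondition.lintegral_edist_sq_ne_top (hE₀ : IsInitialCondition E₀) :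
    ∫⁻ x in E₀, edist x 0 ^ 2 ≠ ∞ := by
  refine ne_top_of_le_ne_top hE₀.moment_lt_top.ne (lintegral_mono fun x ↦ ?_)
  rw [edist_zero_right, ← ofReal_norm, ← ENNReal.ofReal_pow (norm_nonneg x)]
  exact ENNReal.ofReal_le_ofReal (le_add_of_nonneg_left zero_le_one)

theorem IsInitialCondition.energy_ne_top (hE₀ : IsInitialCondition E₀) (hk : IsKernel k) :
    energy k E₀ ≠ ∞ := by
  refine ENNReal.add_ne_top.2 ⟨hE₀.perimeter_lt_top.ne,
    ne_top_of_le_ne_top hE₀.volume_ne_top ?_⟩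
  rw [← setLIntegral_one]
  exact lintegral_mono fun x ↦ hk.convIndicator_le_one _ x

theorem IsMinimizingMovement.W2sq_div_add_energy_le (hE : IsMinimizingMovement k h E₀ E) {n : ℕ}
    (hn : volume (E n) ≠ ∞) :
    W2sq (E (n + 1)) (E n) / ENNReal.ofReal (2 * h) + energy k (E (n + 1)) ≤ energy k (E n) := by
  simpa only [stepFunctional, W2sq_self hn, ENNReal.zero_div, zero_add]
    using hE.minimal n (E n) (hE.measurable n)

theorem IsMinimizingMovement.volume_eq_and_energy_le (hE : IsMinimizingMovement k h E₀ E)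
    (hk : IsKernel k) (hE₀ : IsInitialCondition E₀) (n : ℕ) :
    volume (E n) = volume E₀ ∧ energy k (E n) ≤ energy k E₀ := by
  induction n with
  | zero => simp [hE.init]
  | succ n ih =>
    have hstep := (hE.W2sq_div_add_energy_le (ih.1 ▸ hE₀.volume_ne_top)).trans ih.2
    have hW : W2sq (E (n + 1)) (E n) ≠ ∞ := fun htop ↦ hE₀.energy_ne_top hk <| by
      rwa [htop, ENNReal.top_div_of_ne_top ENNReal.ofReal_ne_top, top_add, top_le_iff] at hstep
    exact ⟨(volume_eq_of_W2sq_ne_top hW).trans ih.1, le_add_self.trans hstep⟩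

theorem IsMinimizingMovement.isAdmissible (hE : IsMinimizingMovement k h E₀ E) (hk : IsKernel k)
    (hE₀ : IsInitialCondition E₀) (n : ℕ) :
    IsAdmissible (volume E₀) (energy k E₀) (E n) where
  measurable := hE.measurable n
  volume_eq := (hE.volume_eq_and_energy_le hk hE₀ n).1
  perimeter_le := (perimeter_le_energy k _).trans (hE.volume_eq_and_energy_le hk hE₀ n).2

theorem IsMinimizingMovement.sum_W2sq_div_add_energy_le (hE : IsMinimizingMovement k h E₀ E)
    (hk : IsKernel k) (hE₀ : IsInitialCondition E₀) (n j : ℕ) :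
    (∑ i ∈ Finset.range j, W2sq (E (n + i + 1)) (E (n + i))) / ENNReal.ofReal (2 * h)
      + energy k (E (n + j)) ≤ energy k (E n) := by
  induction j with
  | zero => simp
  | succ j ih =>
    have hstep := hE.W2sq_div_add_energy_le (n := n + j) <|
      (hE.isAdmissible hk hE₀ _).volume_eq ▸ hE₀.volume_ne_top
    rw [Finset.sum_range_succ, ENNReal.add_div, add_assoc]
    exact (add_le_add_right hstep _).trans ih

theorem W2_le_sum (E : ℕ → Set (EuclideanSpace ℝ (Fin d))) {n : ℕ} (hn : volume (E n) ≠ ∞)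
    (j : ℕ) :
    W2 (E (n + j)) (E n) ≤ ∑ i ∈ Finset.range j, W2 (E (n + i + 1)) (E (n + i)) := by
  induction j with
  | zero => simp [W2, W2sq_self hn]
  | succ j ih =>
    have htriangle : W2 (E (n + (j + 1))) (E n) ≤
        W2 (E (n + j + 1)) (E (n + j)) + W2 (E (n + j)) (E n) := by
      simpa only [W2_eq_wasserstein, ← add_assoc] using wasserstein_triangle
    rw [Finset.sum_range_succ, add_comm (∑ i ∈ _, _)]
    exact htriangle.trans (add_le_add_right ih _)

theorem IsMinimizingMovement.W2sq_le (hE : IsMinimizingMovement k h E₀ E) (hh : 0 < h)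
    (hk : IsKernel k) (hE₀ : IsInitialCondition E₀) (n j : ℕ) :
    W2sq (E (n + j)) (E n) ≤ ENNReal.ofReal (2 * (j * h)) * energy k E₀ := by
  have hsq (A B : Set (EuclideanSpace ℝ (Fin d))) : W2 A B ^ (2 : ℝ) = W2sq A B := by
    rw [W2, ← ENNReal.rpow_mul, one_div_mul_cancel two_ne_zero, ENNReal.rpow_one]
  have hdissipation : ∑ i ∈ Finset.range j, W2sq (E (n + i + 1)) (E (n + i)) ≤
      energy k E₀ * ENNReal.ofReal (2 * h) := by
    rw [← ENNReal.div_le_iff_le_mul (.inl (ENNReal.ofReal_pos.2 (by positivity)).ne')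
      (.inl ENNReal.ofReal_ne_top)]
    exact le_self_add.trans <| (hE.sum_W2sq_div_add_energy_le hk hE₀ n j).trans
      (hE.volume_eq_and_energy_le hk hE₀ n).2
  calc W2sq (E (n + j)) (E n)
    _ = W2 (E (n + j)) (E n) ^ (2 : ℝ) := (hsq _ _).symm
    _ ≤ (∑ i ∈ Finset.range j, W2 (E (n + i + 1)) (E (n + i))) ^ (2 : ℝ) := by
        gcongr
        exact W2_le_sum E ((hE.isAdmissible hk hE₀ n).volume_eq ▸ hE₀.volume_ne_top) j
    _ ≤ j * ∑ i ∈ Finset.range j, W2sq (E (n + i + 1)) (E (n + i)) := by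
        refine (ENNReal.rpow_sum_le_const_mul_sum_rpow _ _ one_le_two).trans_eq ?_
        norm_num [hsq]
    _ ≤ j * (energy k E₀ * ENNReal.ofReal (2 * h)) := by gcongr
    _ = ENNReal.ofReal (2 * (j * h)) * energy k E₀ := by
        rw [mul_left_comm 2 (j : ℝ), ENNReal.ofReal_mul j.cast_nonneg, ENNReal.ofReal_natCast]
        ring

theorem IsMinimizingMovement.W2sq_interpolate_le (hE : IsMinimizingMovement k h E₀ E) (hh : 0 < h)
    (hk : IsKernel k) (hE₀ : IsInitialCondition E₀) {s t : ℝ} (hs : 0 ≤ s) (hst : s ≤ t) :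
    W2sq (interpolate h E t) (interpolate h E s) ≤
      ENNReal.ofReal (2 * (t - s + h)) * energy k E₀ := by
  have hfloor : ⌊s / h⌋₊ ≤ ⌊t / h⌋₊ := Nat.floor_mono (by gcongr)
  have ht : ⌊t / h⌋₊ * h ≤ t := (le_div_iff₀ hh).1 (Nat.floor_le (div_nonneg (hs.trans hst) hh.le))
  have hs' : s < (⌊s / h⌋₊ + 1) * h := (div_lt_iff₀ hh).1 (Nat.lt_floor_add_one _)
  have hsteps := hE.W2sq_le hh hk hE₀ ⌊s / h⌋₊ (⌊t / h⌋₊ - ⌊s / h⌋₊)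
  rw [Nat.add_sub_cancel' hfloor, Nat.cast_sub hfloor] at hsteps
  refine hsteps.trans ?_
  gcongr
  linarith

theorem IsMinimizingMovement.lintegral_edist_sq_interpolate_le
    (hE : IsMinimizingMovement k h E₀ E) (hh : 0 < h) (hk : IsKernel k)
    (hE₀ : IsInitialCondition E₀) {t : ℝ} (ht : 0 ≤ t) :
    ∫⁻ x in interpolate h E t, edist x 0 ^ 2 ≤ 2 * (∫⁻ x in E₀, edist x 0 ^ 2) +
      2 * (ENNReal.ofReal (2 * (t + h)) * energy k E₀) := by
  have hW := hE.W2sq_interpolate_le hh hk hE₀ le_rfl ht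
  have hinit : interpolate h E 0 = E₀ := by rw [interpolate, zero_div, Nat.floor_zero, hE.init]
  rw [hinit, sub_zero, W2sq_eq_wassersteinSq] at hW
  exact (lintegral_edist_sq_le 0).trans (by gcongr)

end Discrete

section LowerSemicontinuity

variable {d : ℕ} {ξ : EuclideanSpace ℝ (Fin d) → EuclideanSpace ℝ (Fin d)} {ι : Type*}
  {l : Filter ι} {S T : ι → Set (EuclideanSpace ℝ (Fin d))} {A B : Set (EuclideanSpace ℝ (Fin d))}
  {V P M : ℝ≥0∞}

theorem continuous_divergence (hξ : ContDiff ℝ 1 ξ) : Continuous (divergence ξ) := by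
  have : Continuous (fderiv ℝ ξ) := hξ.continuous_fderiv one_ne_zero
  unfold divergence
  fun_prop

theorem hasCompactSupport_divergence (hc : HasCompactSupport ξ) :
    HasCompactSupport (divergence ξ) :=
  (hc.fderiv ℝ).comp_left
    (g := fun D : EuclideanSpace ℝ (Fin d) →L[ℝ] EuclideanSpace ℝ (Fin d) ↦
      ∑ i, D (EuclideanSpace.single i 1) i) (by simp)

theorem perimeter_le_of_tendsto_symmDiff [l.NeBot] (hS : ∀ i, NullMeasurableSet (S i))
    (hA : NullMeasurableSet A) (hSA : Tendsto (fun i ↦ volume (S i ∆ A)) l (𝓝 0))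
    (hP : ∀ i, perimeter (S i) ≤ P) : perimeter A ≤ P := by
  refine iSup_le fun ξ ↦ iSup_le fun hξ ↦ iSup_le fun hc ↦ iSup_le fun hξ1 ↦ ?_
  have hcont := continuous_divergence hξ
  have hsupp := hasCompactSupport_divergence hc
  obtain ⟨M, hM⟩ := hsupp.exists_bound_of_continuous hcont
  have hlim := tendsto_setIntegral_of_tendsto_symmDiff hS hA hSA
    (hcont.integrable_of_hasCompactSupport hsupp) hM
  refine le_of_tendsto' (ENNReal.tendsto_ofReal hlim.neg) fun i ↦ le_trans ?_ (hP i)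
  exact le_iSup_of_le ξ (le_iSup_of_le hξ (le_iSup_of_le hc (le_iSup_of_le hξ1 le_rfl)))

theorem IsAdmissible.of_tendsto_symmDiff [l.NeBot] (hS : ∀ i, IsAdmissible V P (S i))
    (hA : NullMeasurableSet A) (hSA : Tendsto (fun i ↦ volume (S i ∆ A)) l (𝓝 0)) :
    IsAdmissible V P A where
  measurable := hA
  volume_eq := measure_eq_of_tendsto_symmDiff hSA fun i ↦ (hS i).volume_eq
  perimeter_le := perimeter_le_of_tendsto_symmDiff (fun i ↦ (hS i).measurable) hA hSA
    fun i ↦ (hS i).perimeter_le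

theorem W2sq_le_of_tendsto_symmDiff [l.NeBot] (hA : MeasurableSet A) (hB : MeasurableSet B)
    (hSV : ∀ i, volume (S i) = V) (hTV : ∀ i, volume (T i) = V)
    (hSA : Tendsto (fun i ↦ volume (S i ∆ A)) l (𝓝 0))
    (hTB : Tendsto (fun i ↦ volume (T i ∆ B)) l (𝓝 0)) (hM : M ≠ ∞)
    (hSM : ∀ i, ∫⁻ x in S i, edist x 0 ^ 2 ≤ M) (hTM : ∀ i, ∫⁻ x in T i, edist x 0 ^ 2 ≤ M)
    {w : ι → ℝ≥0∞} {w₀ : ℝ≥0∞} (hw : Tendsto w l (𝓝 w₀)) (hle : ∀ i, W2sq (S i) (T i) ≤ w i) :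
    W2sq A B ≤ w₀ := by
  simp only [W2sq_eq_wassersteinSq] at hle ⊢
  have hmoment : Measurable fun x : EuclideanSpace ℝ (Fin d) ↦ edist x 0 ^ 2 := by fun_prop
  exact wassersteinSq_restrict_le_of_tendsto hA hB
    (ne_top_of_le_ne_top hM (setLIntegral_le_of_tendsto_symmDiff hSA hmoment hSM))
    (ne_top_of_le_ne_top hM (setLIntegral_le_of_tendsto_symmDiff hTB hmoment hTM))
    (fun i ↦ (hSV i).trans (measure_eq_of_tendsto_symmDiff hSA hSV).symm)
    (fun i ↦ (hTV i).trans (measure_eq_of_tendsto_symmDiff hTB hTV).symm) hSA hTB hw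
    (.of_forall hle)

end LowerSemicontinuity

section MeasuredSets

variable {α : Type*}

theorem symmDiff_limsup_subset (u : ℕ → Set α) (n : ℕ) :
    u n ∆ limsup u atTop ⊆ ⋃ i, u (i + n) ∆ u (i + n + 1) := by
  intro x hx
  by_contra hstep
  simp only [Set.mem_iUnion, Set.mem_symmDiff, not_exists] at hstep
  have hconst (i : ℕ) : x ∈ u (i + n) ↔ x ∈ u n := by
    induction i with
    | zero => rw [zero_add]
    | succ i ih =>
      rw [← ih, Nat.add_right_comm]
      have := hstep i
      tauto
  have hlimsup : x ∈ limsup u atTop ↔ x ∈ u n := by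
    rw [mem_limsup_iff_frequently_mem, ← frequently_const (f := atTop (α := ℕ)) (p := x ∈ u n)]
    refine frequently_congr ((eventually_ge_atTop n).mono fun i hi ↦ ?_)
    rw [← hconst (i - n), Nat.sub_add_cancel hi]
  rcases hx with hx | hx
  · exact hx.2 (hlimsup.2 hx.1)
  · exact hx.2 (hlimsup.1 hx.1)

variable [MeasurableSpace α] {μ : Measure α}

instance : CompleteSpace (MeasuredSets μ) := by
  refine EMetric.complete_of_convergent_controlled_sequences (fun n ↦ (2⁻¹ : ℝ≥0∞) ^ n)
    (fun n ↦ ENNReal.pow_pos (by simp) n) fun u hu ↦ ?_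
  let limit : MeasuredSets μ :=
    ⟨limsup (fun n ↦ (u n : Set α)) atTop, .measurableSet_limsup fun n ↦ (u n).2⟩
  have hsummable : ∑' n, (2⁻¹ : ℝ≥0∞) ^ n ≠ ∞ := by
    rw [ENNReal.tsum_geometric]
    norm_num
  refine ⟨limit, tendsto_iff_edist_tendsto_0.2 <| tendsto_of_tendsto_of_tendsto_of_le_of_le
    tendsto_const_nhds (ENNReal.tendsto_sum_nat_add _ hsummable) (fun _ ↦ zero_le) fun n ↦ ?_⟩
  calc edist (u n) limit
    _ ≤ μ (⋃ i, (u (i + n) : Set α) ∆ u (i + n + 1)) :=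
        measure_mono (symmDiff_limsup_subset (fun n ↦ (u n : Set α)) n)
    _ ≤ ∑' i, μ ((u (i + n) : Set α) ∆ u (i + n + 1)) := measure_iUnion_le _
    _ ≤ ∑' i, (2⁻¹ : ℝ≥0∞) ^ (i + n) :=
        ENNReal.tsum_le_tsum fun i ↦ (hu _ _ _ le_rfl (Nat.le_succ _)).le

/-- The point of `MeasuredSets μ` represented by a set `A`. Since `MeasuredSets μ` only contains
measurable sets, `A` is replaced by its measurable hull `toMeasurable μ A`, which is a.e. equal to
`A` if `A` is null-measurable. -/
def toMeasuredSets (μ : Measure α) (A : Set α) : MeasuredSets μ :=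
  ⟨toMeasurable μ A, measurableSet_toMeasurable μ A⟩

theorem coe_toMeasuredSets_ae_eq {A : Set α} (hA : NullMeasurableSet A μ) :
    (toMeasuredSets μ A : Set α) =ᵐ[μ] A :=
  hA.toMeasurable_ae_eq

theorem edist_toMeasuredSets_left {A : Set α} (hA : NullMeasurableSet A μ) (B : MeasuredSets μ) :
    edist (toMeasuredSets μ A) B = μ (A ∆ B) :=
  measure_symmDiff_congr (coe_toMeasuredSets_ae_eq hA) .rfl

theorem edist_toMeasuredSets {A B : Set α} (hA : NullMeasurableSet A μ)
    (hB : NullMeasurableSet B μ) :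
    edist (toMeasuredSets μ A) (toMeasuredSets μ B) = μ (A ∆ B) :=
  measure_symmDiff_congr (coe_toMeasuredSets_ae_eq hA) (coe_toMeasuredSets_ae_eq hB)

end MeasuredSets

section TotalBoundedness

theorem totallyBounded_image_of_forall_exists {α X : Type*} [PseudoEMetricSpace X] {f : α → X}
    {s : Set α}
    (h : ∀ ε > 0, ∃ (Y : Type) (_ : PseudoMetricSpace Y) (Φ : α → Y), TotallyBounded (Φ '' s) ∧
      ∃ δ > 0, ∀ x ∈ s, ∀ y ∈ s, dist (Φ x) (Φ y) < δ → edist (f x) (f y) < ε) :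
    TotallyBounded (f '' s) := by
  refine EMetric.totallyBounded_iff.2 fun ε hε ↦ ?_
  obtain ⟨Y, _, Φ, hΦ, δ, hδ, hclose⟩ := h ε hε
  obtain ⟨t, hts, htfin, hcover⟩ := Set.exists_subset_image_finite_and.1 <|
    hΦ.exists_subset (Metric.dist_mem_uniformity hδ)
  refine ⟨f '' t, htfin.image f, ?_⟩
  rintro _ ⟨x, hx, rfl⟩
  obtain ⟨_, ⟨y, hy, rfl⟩, hxy⟩ := Set.mem_iUnion₂.1 (hcover (Set.mem_image_of_mem Φ hx))
  exact Set.mem_biUnion (Set.mem_image_of_mem f hy) (hclose x hx y (hts hy) hxy)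

section Discretization

variable {α : Type*} [MeasurableSpace α] {μ ν : Measure α}

theorem integral_comp_simpleFunc {β : Type*} [IsFiniteMeasure μ] (π : SimpleFunc α β) (g : β → ℝ) :
    ∫ x, g (π x) ∂μ = ∑ p ∈ π.range, μ.real (π ⁻¹' {p}) * g p := by
  have hint : Integrable (fun x ↦ g (π x)) μ := (π.map g).integrable_of_isFiniteMeasure
  have hcover : ⋃ p ∈ π.range, π ⁻¹' {p} = Set.univ :=
    Set.eq_univ_of_forall fun x ↦ Set.mem_biUnion (SimpleFunc.mem_range_self π x) rfl
  rw [← setIntegral_univ, ← hcover, integral_biUnion_finset _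
    (fun p _ ↦ π.measurableSet_fiber p)
    (fun p _ q _ hpq ↦ Disjoint.preimage π (Set.disjoint_singleton.2 hpq))
    fun p _ ↦ hint.integrableOn]
  refine Finset.sum_congr rfl fun p _ ↦ ?_
  rw [setIntegral_congr_fun (g := fun _ ↦ g p) (π.measurableSet_fiber p)
    fun x hx ↦ congrArg g hx, setIntegral_const, smul_eq_mul]

theorem integral_comp_simpleFunc_sub_le {β : Type*} [IsFiniteMeasure μ] [IsFiniteMeasure ν]
    (π : SimpleFunc α β) {g : β → ℝ} (hg : ∀ p, |g p| ≤ 1) {δ : ℝ}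
    (hδ : ∀ p ∈ π.range, |μ.real (π ⁻¹' {p}) - ν.real (π ⁻¹' {p})| ≤ δ) :
    ∫ x, g (π x) ∂μ - ∫ x, g (π x) ∂ν ≤ π.range.card * δ := by
  rw [integral_comp_simpleFunc, integral_comp_simpleFunc, ← Finset.sum_sub_distrib, ← nsmul_eq_mul]
  refine Finset.sum_le_card_nsmul _ _ _ fun p hp ↦ ?_
  rw [← sub_mul]
  refine (le_abs_self _).trans ?_
  rw [abs_mul]
  exact (mul_le_of_le_one_right (abs_nonneg _) (hg p)).trans (hδ p hp)

variable [PseudoMetricSpace α] [OpensMeasurableSpace α]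

theorem exists_simpleFunc_forall_dist_le [SecondCountableTopology α] [Nonempty α] {K : Set α}
    (hK : IsCompact K) {η : ℝ} (hη : 0 < η) :
    ∃ π : SimpleFunc α α, ∀ x ∈ K, dist (π x) x ≤ η := by
  let e := TopologicalSpace.denseSeq α
  have hcover : K ⊆ ⋃ k, Metric.ball (e k) η := fun x _ ↦ Set.mem_iUnion.2 <|
    let ⟨k, hk⟩ := (TopologicalSpace.denseRange_denseSeq α).exists_dist_lt x hη
    ⟨k, hk⟩
  obtain ⟨t, ht⟩ := hK.elim_finite_subcover _ (fun _ ↦ Metric.isOpen_ball) hcover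
  refine ⟨SimpleFunc.nearestPt e (t.sup id), fun x hx ↦ ?_⟩
  obtain ⟨k, hk, hxk⟩ := Set.mem_iUnion₂.1 (ht hx)
  have hnearest := SimpleFunc.edist_nearestPt_le e x (Finset.le_sup (f := id) hk)
  rw [edist_dist, edist_dist, ENNReal.ofReal_le_ofReal_iff dist_nonneg] at hnearest
  exact hnearest.trans (Metric.mem_ball'.1 hxk).le

theorem abs_integral_sub_integral_comp_simpleFunc_le [IsFiniteMeasure μ] {g : α → ℝ} {L : ℝ≥0}
    (hg1 : ∀ x, |g x| ≤ 1) (hg : LipschitzWith L g) {K : Set α} (hK : MeasurableSet K)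
    {π : SimpleFunc α α} {η : ℝ} (hη : 0 ≤ η) (hπ : ∀ x ∈ K, dist (π x) x ≤ η) :
    |∫ x, g x ∂μ - ∫ x, g (π x) ∂μ| ≤ L * η * μ.real Set.univ + 2 * μ.real Kᶜ := by
  have hint : Integrable g μ := .of_bound hg.continuous.aestronglyMeasurable 1 (.of_forall hg1)
  have hintπ : Integrable (fun x ↦ g (π x)) μ := (π.map g).integrable_of_isFiniteMeasure
  have hpointwise (x : α) : |g x - g (π x)| ≤ L * η + Kᶜ.indicator (fun _ ↦ 2) x := by
    by_cases hx : x ∈ K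
    · rw [Set.indicator_of_notMem (Set.notMem_compl_iff.2 hx), add_zero, ← Real.dist_eq, dist_comm]
      exact (hg.dist_le_mul _ _).trans (mul_le_mul_of_nonneg_left (hπ x hx) L.2)
    · rw [Set.indicator_of_mem hx]
      have := abs_sub (g x) (g (π x))
      have : 0 ≤ L * η := by positivity
      linarith [hg1 x, hg1 (π x)]
  have hind : Integrable (Kᶜ.indicator fun _ ↦ (2 : ℝ)) μ := (integrable_const 2).indicator hK.compl
  calc |∫ x, g x ∂μ - ∫ x, g (π x) ∂μ|
    _ = |∫ x, g x - g (π x) ∂μ| := by rw [integral_sub hint hintπ]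
    _ ≤ ∫ x, L * η + Kᶜ.indicator (fun _ ↦ 2) x ∂μ :=
        (abs_integral_le_integral_abs).trans
          (integral_mono (hint.sub hintπ).abs ((integrable_const _).add hind) hpointwise)
    _ = L * η * μ.real Set.univ + 2 * μ.real Kᶜ := by
        rw [integral_add (integrable_const _) hind, integral_const, smul_eq_mul,
          integral_indicator_const _ hK.compl, smul_eq_mul]
        ring

theorem exists_forall_measure_compl_closedBall_le (a : α) {M ε : ℝ≥0∞} (hM : M ≠ ∞) (hε : ε ≠ 0) :
    ∃ R, ∀ μ : Measure α, ∫⁻ x, edist x a ^ 2 ∂μ ≤ M → μ (Metric.closedBall a R)ᶜ ≤ ε := by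
  obtain ⟨n, hn⟩ := ENNReal.exists_nat_gt (ENNReal.div_ne_top hM hε)
  have hn0 : n ≠ 0 := fun h ↦ by simp [h] at hn
  refine ⟨n, fun μ hμ ↦ ?_⟩
  calc μ (Metric.closedBall a n)ᶜ
    _ ≤ μ {x | (n : ℝ≥0∞) ≤ edist x a ^ 2} := measure_mono fun x hx ↦ by
        have hdist : (n : ℝ) < dist x a := by simpa using hx
        have hedist : (n : ℝ≥0∞) ≤ edist x a := by
          rw [edist_dist, ← ENNReal.ofReal_natCast]
          exact ENNReal.ofReal_le_ofReal hdist.le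
        calc (n : ℝ≥0∞)
          _ ≤ n ^ 2 := mod_cast Nat.le_self_pow two_ne_zero n
          _ ≤ edist x a ^ 2 := by gcongr
    _ ≤ (∫⁻ x, edist x a ^ 2 ∂μ) / n :=
        meas_ge_le_lintegral_div (by fun_prop) (by simpa using hn0) (ENNReal.natCast_ne_top n)
    _ ≤ ε := by
        refine ENNReal.div_le_of_le_mul (hμ.trans ?_)
        rw [mul_comm]
        exact (ENNReal.div_le_iff_le_mul (.inl hε) (.inr (Nat.cast_ne_zero.2 hn0))).1 hn.le

end Discretization

variable {d : ℕ} {A B K : Set (EuclideanSpace ℝ (Fin d))} {V P M : ℝ≥0∞}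

theorem IsMollifier.measureReal_symmDiff_le_of_simpleFunc {φ : EuclideanSpace ℝ (Fin d) → ℝ}
    {L : ℝ≥0} (hφ : IsMollifier volume φ L) (hV : V ≠ ∞) (hP : P ≠ ∞) (hA : IsAdmissible V P A)
    (hB : IsAdmissible V P B) {r η τ δ : ℝ} (hr : 0 < r) (hη : 0 ≤ η) (hK : MeasurableSet K)
    {π : SimpleFunc (EuclideanSpace ℝ (Fin d)) (EuclideanSpace ℝ (Fin d))}
    (hπ : ∀ x ∈ K, dist (π x) x ≤ η) (hAK : (volume.restrict A).real Kᶜ ≤ τ)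
    (hBK : (volume.restrict B).real Kᶜ ≤ τ)
    (hδ : ∀ p ∈ π.range, |(volume.restrict A).real (π ⁻¹' {p}) -
      (volume.restrict B).real (π ⁻¹' {p})| ≤ δ) :
    volume.real (A ∆ B) ≤
      r * (2 * P.toReal) + (2 * (L / r * η * V.toReal + 2 * τ) + π.range.card * δ) := by
  have hvA : volume A ≠ ∞ := hA.volume_eq ▸ hV
  have hvB : volume B ≠ ∞ := hB.volume_eq ▸ hV
  have : IsFiniteMeasure (volume.restrict A) := isFiniteMeasure_restrict.2 hvA
  have : IsFiniteMeasure (volume.restrict B) := isFiniteMeasure_restrict.2 hvB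
  have hPA := ENNReal.toReal_mono hP hA.perimeter_le
  have hPB := ENNReal.toReal_mono hP hB.perimeter_le
  refine (hφ.measureReal_symmDiff_le hA.measurable hB.measurable hvA hvB
    (ne_top_of_le_ne_top hP hA.perimeter_le) (ne_top_of_le_ne_top hP hB.perimeter_le) hr
    (B := 2 * (L / r * η * V.toReal + 2 * τ) + π.range.card * δ) fun G hG1 hG ↦ ?_).trans ?_
  · have hLip : LipschitzWith (L / r.toNNReal) G := .of_dist_le_mul fun x y ↦ by
      rw [NNReal.coe_div, Real.coe_toNNReal r hr.le, Real.dist_eq, dist_eq_norm]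
      exact hG x y
    have hGA := abs_le.1 <|
      abs_integral_sub_integral_comp_simpleFunc_le (μ := volume.restrict A) hG1 hLip hK hη hπ
    have hGB := abs_le.1 <|
      abs_integral_sub_integral_comp_simpleFunc_le (μ := volume.restrict B) hG1 hLip hK hη hπ
    simp only [NNReal.coe_div, Real.coe_toNNReal r hr.le, measureReal_restrict_apply_univ,
      Measure.real_def volume, hA.volume_eq, hB.volume_eq] at hGA hGB
    linarith [integral_comp_simpleFunc_sub_le π hG1 hδ, hGA.2, hGB.1]
  · gcongr
    linarith

theorem exists_simpleFunc_volume_symmDiff_lt (d : ℕ) (hV : V ≠ ∞) (hP : P ≠ ∞) (hM : M ≠ ∞)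
    {ε : ℝ≥0∞} (hε : 0 < ε) :
    ∃ π : SimpleFunc (EuclideanSpace ℝ (Fin d)) (EuclideanSpace ℝ (Fin d)), ∃ δ > 0, ∀ A B,
      IsAdmissible V P A → ∫⁻ x in A, edist x 0 ^ 2 ≤ M →
      IsAdmissible V P B → ∫⁻ x in B, edist x 0 ^ 2 ≤ M →
      (∀ p ∈ π.range, |(volume.restrict A).real (π ⁻¹' {p}) -
        (volume.restrict B).real (π ⁻¹' {p})| ≤ δ) → volume (A ∆ B) < ε := by
  obtain ⟨φ, L, hφ⟩ := exists_isMollifier (μ := (volume : Measure (EuclideanSpace ℝ (Fin d))))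
  obtain ⟨ε', hε', hεε'⟩ := ENNReal.lt_iff_exists_nnreal_btwn.1 hε
  have hε'_pos : (0 : ℝ) < ε' := mod_cast hε'
  obtain ⟨r, hr, hrε⟩ := exists_pos_mul_lt (by positivity : (0 : ℝ) < ε' / 4) (2 * P.toReal)
  obtain ⟨η, hη, hηε⟩ := exists_pos_mul_lt (by positivity : (0 : ℝ) < ε' / 4)
    (2 * (L / r * V.toReal))
  obtain ⟨R, hR⟩ := exists_forall_measure_compl_closedBall_le (0 : EuclideanSpace ℝ (Fin d)) hM
    (by simpa using hε'_pos : ENNReal.ofReal (ε' / 16) ≠ 0)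
  obtain ⟨π, hπ⟩ := exists_simpleFunc_forall_dist_le
    (isCompact_closedBall (0 : EuclideanSpace ℝ (Fin d)) R) hη
  obtain ⟨δ, hδ, hδε⟩ := exists_pos_mul_lt (by positivity : (0 : ℝ) < ε' / 4) (π.range.card : ℝ)
  refine ⟨π, δ, hδ, fun A B hA hAM hB hBM hAB ↦ ?_⟩
  have htail {S : Set (EuclideanSpace ℝ (Fin d))} (hS : ∫⁻ x in S, edist x 0 ^ 2 ≤ M) :
      (volume.restrict S).real (Metric.closedBall 0 R)ᶜ ≤ ε' / 16 :=
    ENNReal.toReal_le_of_le_ofReal (by positivity) (hR _ hS)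
  have hle := hφ.measureReal_symmDiff_le_of_simpleFunc hV hP hA hB hr hη.le
    Metric.isClosed_closedBall.measurableSet hπ (htail hAM) (htail hBM) hAB
  have hfin : volume (A ∆ B) ≠ ∞ :=
    measure_symmDiff_ne_top (hA.volume_eq ▸ hV) (hB.volume_eq ▸ hV)
  calc volume (A ∆ B)
    _ = ENNReal.ofReal (volume.real (A ∆ B)) := (ofReal_measureReal hfin).symm
    _ ≤ ENNReal.ofReal ε' := ENNReal.ofReal_le_ofReal (by linarith)
    _ = ε' := ENNReal.ofReal_coe_nnreal
    _ < ε := hεε'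

theorem totallyBounded_toMeasuredSets_image (d : ℕ) (hV : V ≠ ∞) (hP : P ≠ ∞) (hM : M ≠ ∞) :
    TotallyBounded (toMeasuredSets volume '' {A : Set (EuclideanSpace ℝ (Fin d)) |
      IsAdmissible V P A ∧ ∫⁻ x in A, edist x 0 ^ 2 ≤ M}) := by
  refine totallyBounded_image_of_forall_exists fun ε hε ↦ ?_
  obtain ⟨π, δ, hδ, hπ⟩ := exists_simpleFunc_volume_symmDiff_lt d hV hP hM hε
  refine ⟨π.range → ℝ, inferInstance, fun A p ↦ (volume.restrict A).real (π ⁻¹' {p.1}),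
    (isCompact_univ_pi fun _ ↦ isCompact_Icc (a := 0) (b := V.toReal)).totallyBounded.subset ?_,
    δ, hδ, ?_⟩
  · rintro _ ⟨A, ⟨hA, -⟩, rfl⟩ p -
    refine ⟨measureReal_nonneg, ENNReal.toReal_mono hV ?_⟩
    exact (measure_mono (Set.subset_univ _)).trans_eq <| by
      rw [Measure.restrict_apply_univ, hA.volume_eq]
  · rintro A ⟨hA, hAM⟩ B ⟨hB, hBM⟩ hAB
    rw [edist_toMeasuredSets hA.measurable hB.measurable]
    exact hπ A B hA hAM hB hBM fun p hp ↦ (dist_le_pi_dist _ _ (⟨p, hp⟩ : π.range)).trans hAB.le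

end TotalBoundedness

section ArzelaAscoli

variable {X : Type*} [PseudoEMetricSpace X] [CompleteSpace X]

theorem exists_subseq_forall_tendsto_of_totallyBounded {ι : Type*} [Countable ι] {f : ℕ → ι → X}
    (hf : ∀ i, TotallyBounded (Set.range fun n ↦ f n i)) :
    ∃ φ : ℕ → ℕ, StrictMono φ ∧ ∃ g : ι → X, ∀ i, Tendsto (fun j ↦ f (φ j) i) atTop (𝓝 (g i)) := by
  have hcompact : IsCompact (Set.univ.pi fun i ↦ closure (Set.range fun n ↦ f n i)) :=
    isCompact_univ_pi fun i ↦ (hf i).closure.isCompact_of_isClosed isClosed_closure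
  obtain ⟨g, -, φ, hφ, hg⟩ :=
    hcompact.tendsto_subseq fun n i _ ↦ subset_closure (Set.mem_range_self n)
  exact ⟨φ, hφ, g, tendsto_pi_nhds.1 hg⟩

variable {S : Type*} [PseudoMetricSpace S] {f : ℕ → S → X}

theorem exists_tendstoLocallyUniformly_of_denseRange {ι : Type*} {q : ι → S} (hq : DenseRange q)
    (hcauchy : ∀ i, CauchySeq fun n ↦ f n (q i))
    (hequi : ∀ ε > 0, ∃ δ > 0, ∀ᶠ n in atTop, ∀ s t, dist s t < δ → edist (f n s) (f n t) < ε) :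
    ∃ g : S → X, TendstoLocallyUniformly f g atTop := by
  have hlocal {ε : ℝ≥0∞} (hε : 0 < ε) (s : S) :
      ∃ U ∈ 𝓝 s, ∃ N, ∀ m ≥ N, ∀ n ≥ N, ∀ t ∈ U, edist (f m t) (f n t) < ε := by
    obtain ⟨δ, hδ, hδ'⟩ := hequi (ε / 3) (ENNReal.div_pos hε.ne' (by simp))
    obtain ⟨N₁, hN₁⟩ := eventually_atTop.1 hδ'
    obtain ⟨i, hi⟩ := hq.exists_dist_lt s (half_pos hδ)
    obtain ⟨N₂, hN₂⟩ :=
      EMetric.cauchySeq_iff.1 (hcauchy i) (ε / 3) (ENNReal.div_pos hε.ne' (by simp))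
    refine ⟨Metric.ball s (δ / 2), Metric.ball_mem_nhds s (half_pos hδ), max N₁ N₂,
      fun m hm n hn t ht ↦ ?_⟩
    have hti : dist t (q i) < δ := by
      linarith [dist_triangle t s (q i), Metric.mem_ball.1 ht]
    calc edist (f m t) (f n t)
      _ ≤ edist (f m t) (f m (q i)) + edist (f m (q i)) (f n (q i)) + edist (f n (q i)) (f n t) :=
          edist_triangle4 _ _ _ _
      _ < ε / 3 + ε / 3 + ε / 3 := by
          gcongr
          · exact hN₁ m (le_of_max_le_left hm) t (q i) hti
          · exact hN₂ m (le_of_max_le_right hm) n (le_of_max_le_right hn)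
          · exact hN₁ n (le_of_max_le_left hn) (q i) t (dist_comm t (q i) ▸ hti)
      _ = ε := ENNReal.add_thirds ε
  have hpointwise (s : S) : ∃ a, Tendsto (fun n ↦ f n s) atTop (𝓝 a) :=
    cauchySeq_tendsto_of_complete <| EMetric.cauchySeq_iff.2 fun ε hε ↦
      let ⟨_, hU, N, hN⟩ := hlocal hε s
      ⟨N, fun m hm n hn ↦ hN m hm n hn s (mem_of_mem_nhds hU)⟩
  choose g hg using hpointwise
  refine ⟨g, EMetric.tendstoLocallyUniformly_iff.2 fun ε hε s ↦ ?_⟩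
  obtain ⟨ε', hε', hεε'⟩ := exists_between hε
  obtain ⟨U, hU, N, hN⟩ := hlocal hε' s
  refine ⟨U, hU, eventually_atTop.2 ⟨N, fun n hn t ht ↦ lt_of_le_of_lt ?_ hεε'⟩⟩
  exact le_of_tendsto ((hg t).edist tendsto_const_nhds)
    (eventually_atTop.2 ⟨N, fun m hm ↦ (hN m hm n hn t ht).le⟩)

theorem exists_subseq_tendstoLocallyUniformly [TopologicalSpace.SeparableSpace S] [Nonempty S]
    (hf : ∀ s, TotallyBounded (Set.range fun n ↦ f n s))
    (hequi : ∀ ε > 0, ∃ δ > 0, ∀ᶠ n in atTop, ∀ s t, dist s t < δ → edist (f n s) (f n t) < ε) :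
    ∃ φ : ℕ → ℕ, StrictMono φ ∧ ∃ g : S → X, TendstoLocallyUniformly (fun j ↦ f (φ j)) g atTop := by
  obtain ⟨φ, hφ, _, hlim⟩ := exists_subseq_forall_tendsto_of_totallyBounded
    fun i ↦ hf (TopologicalSpace.denseSeq S i)
  refine ⟨φ, hφ, exists_tendstoLocallyUniformly_of_denseRange
    (TopologicalSpace.denseRange_denseSeq S) (fun i ↦ (hlim i).cauchySeq) fun ε hε ↦ ?_⟩
  obtain ⟨δ, hδ, hδ'⟩ := hequi ε hε
  exact ⟨δ, hδ, hφ.tendsto_atTop.eventually hδ'⟩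

end ArzelaAscoli

section Compactness

variable {d : ℕ} {k : EuclideanSpace ℝ (Fin d) → ℝ} {E₀ : Set (EuclideanSpace ℝ (Fin d))}

theorem exists_forall_volume_symmDiff_interpolate_lt (hk : IsKernel k)
    (hE₀ : IsInitialCondition E₀) {ε : ℝ≥0∞} (hε : 0 < ε) :
    ∃ δ > 0, ∀ {h : ℝ} {E : ℕ → Set (EuclideanSpace ℝ (Fin d))}, 0 < h → h < δ →
      IsMinimizingMovement k h E₀ E → ∀ {s t : ℝ}, 0 ≤ s → s ≤ t → t - s < δ →
        volume (interpolate h E t ∆ interpolate h E s) < ε := by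
  obtain ⟨C, -, hC⟩ := exists_holder_estimate d
  let bound (τ : ℝ) : ℝ≥0∞ := ENNReal.ofReal C * volume E₀ ^ (1 / 4 : ℝ) *
    energy k E₀ ^ (3 / 4 : ℝ) * ENNReal.ofReal τ ^ (1 / 4 : ℝ)
  have hbound : Tendsto bound (𝓝 0) (𝓝 0) := by
    have hpow : Tendsto (fun τ : ℝ ↦ ENNReal.ofReal τ ^ (1 / 4 : ℝ)) (𝓝 0) (𝓝 0) := by
      have := (ENNReal.continuous_rpow_const (y := 1 / 4)).comp ENNReal.continuous_ofReal
      simpa [Function.comp_def] using this.tendsto 0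
    have hconst : ENNReal.ofReal C * volume E₀ ^ (1 / 4 : ℝ) * energy k E₀ ^ (3 / 4 : ℝ) ≠ ∞ := by
      have := hE₀.volume_ne_top
      have := hE₀.energy_ne_top hk
      finiteness
    simpa [bound] using ENNReal.Tendsto.const_mul hpow (.inr hconst)
  obtain ⟨ρ, hρ, hρε⟩ := Metric.eventually_nhds_iff.1 (hbound.eventually_lt_const hε)
  refine ⟨ρ / 2, half_pos hρ, fun {h E} hh hhρ hE {s t} hs hst hstρ ↦ ?_⟩
  have hW : W2sq (interpolate h E t) (interpolate h E s) ≤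
      ENNReal.ofReal (4 * (t - s + h)) * energy k E₀ := by
    refine (hE.W2sq_interpolate_le hh hk hE₀ hs hst).trans ?_
    gcongr
    linarith
  refine (hC hE₀.volume_ne_top (hE₀.energy_ne_top hk) (hE.isAdmissible hk hE₀ _)
    (hE.isAdmissible hk hE₀ _) hW).2.trans_lt (hρε ?_)
  rw [Real.dist_eq, sub_zero, abs_of_nonneg (by linarith)]
  linarith

variable {h : ℕ → ℝ} {E : ℕ → ℕ → Set (EuclideanSpace ℝ (Fin d))}

theorem exists_forall_lintegral_edist_sq_interpolate_le (hk : IsKernel k)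
    (hE₀ : IsInitialCondition E₀) (hh : ∀ j, 0 < h j) (hbdd : BddAbove (Set.range h))
    (hE : ∀ j, IsMinimizingMovement k (h j) E₀ (E j)) {t : ℝ} (ht : 0 ≤ t) :
    ∃ M, M ≠ ∞ ∧ ∀ j, ∫⁻ x in interpolate (h j) (E j) t, edist x 0 ^ 2 ≤ M := by
  obtain ⟨H, hH⟩ := hbdd
  have := hE₀.lintegral_edist_sq_ne_top
  have := hE₀.energy_ne_top hk
  refine ⟨2 * (∫⁻ x in E₀, edist x 0 ^ 2) + 2 * (ENNReal.ofReal (2 * (t + H)) * energy k E₀),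
    by finiteness, fun j ↦ ?_⟩
  refine ((hE j).lintegral_edist_sq_interpolate_le (hh j) hk hE₀ ht).trans ?_
  gcongr
  exact hH (Set.mem_range_self j)

theorem exists_subseq_tendsto_interpolate (hk : IsKernel k) (hE₀ : IsInitialCondition E₀)
    (hh : ∀ j, 0 < h j) (hlim : Tendsto h atTop (𝓝 0))
    (hE : ∀ j, IsMinimizingMovement k (h j) E₀ (E j)) :
    ∃ φ : ℕ → ℕ, StrictMono φ ∧ ∃ Elim : ℝ → Set (EuclideanSpace ℝ (Fin d)),
      (∀ t, MeasurableSet (Elim t)) ∧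
      ∀ T : ℝ, Tendsto (fun j ↦ ⨆ t ∈ Set.Icc 0 T,
        volume (interpolate (h (φ j)) (E (φ j)) t ∆ Elim t)) atTop (𝓝 0) := by
  have hmeas (j : ℕ) (t : ℝ) : NullMeasurableSet (interpolate (h j) (E j) t) :=
    ((hE j).isAdmissible hk hE₀ _).measurable
  let f (j : ℕ) (t : ℝ≥0) := toMeasuredSets volume (interpolate (h j) (E j) t)
  have hf (t : ℝ≥0) : TotallyBounded (Set.range fun j ↦ f j t) := by
    obtain ⟨M, hM, hmoment⟩ :=
      exists_forall_lintegral_edist_sq_interpolate_le hk hE₀ hh hlim.bddAbove_range hE t.2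
    refine (totallyBounded_toMeasuredSets_image d hE₀.volume_ne_top
      (hE₀.energy_ne_top hk) hM).subset ?_
    rintro _ ⟨j, rfl⟩
    exact Set.mem_image_of_mem _ ⟨(hE j).isAdmissible hk hE₀ _, hmoment j⟩
  have hequi (ε : ℝ≥0∞) (hε : ε > 0) :
      ∃ δ > 0, ∀ᶠ j in atTop, ∀ s t, dist s t < δ → edist (f j s) (f j t) < ε := by
    obtain ⟨δ, hδ, hclose⟩ := exists_forall_volume_symmDiff_interpolate_lt hk hE₀ hε
    refine ⟨δ, hδ, (hlim.eventually_lt_const hδ).mono fun j hj s t hst ↦ ?_⟩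
    wlog hle : t ≤ s generalizing s t
    · rw [edist_comm]
      exact this t s (dist_comm s t ▸ hst) (le_of_not_ge hle)
    rw [edist_toMeasuredSets (hmeas j s) (hmeas j t)]
    exact hclose (hh j) hj (hE j) t.2 hle ((le_abs_self _).trans_lt hst)
  obtain ⟨φ, hφ, g, hg⟩ := exists_subseq_tendstoLocallyUniformly hf hequi
  refine ⟨φ, hφ, fun t ↦ g t.toNNReal, fun t ↦ (g t.toNNReal).2, fun T ↦ ?_⟩
  have hunif := EMetric.tendstoUniformlyOn_iff.1 <|
    tendstoLocallyUniformly_iff_forall_isCompact.1 hg (Set.Icc 0 T.toNNReal) isCompact_Icc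
  refine ENNReal.tendsto_nhds_zero.2 fun ε hε ↦ (hunif ε hε).mono fun j hj ↦
    iSup₂_le fun t ⟨ht, htT⟩ ↦ ?_
  have hjt := hj t.toNNReal ⟨zero_le, Real.toNNReal_mono htT⟩
  rw [edist_comm, edist_toMeasuredSets_left (hmeas _ _), Real.coe_toNNReal t ht] at hjt
  exact hjt.le

theorem W2sq_le_of_tendsto_interpolate (hk : IsKernel k) (hE₀ : IsInitialCondition E₀)
    (hh : ∀ j, 0 < h j) (hlim : Tendsto h atTop (𝓝 0))
    (hE : ∀ j, IsMinimizingMovement k (h j) E₀ (E j)) {s t : ℝ} (hs : 0 ≤ s) (hst : s ≤ t)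
    {A B : Set (EuclideanSpace ℝ (Fin d))} (hA : MeasurableSet A) (hB : MeasurableSet B)
    (htA : Tendsto (fun j ↦ volume (interpolate (h j) (E j) t ∆ A)) atTop (𝓝 0))
    (hsB : Tendsto (fun j ↦ volume (interpolate (h j) (E j) s ∆ B)) atTop (𝓝 0)) :
    W2sq A B ≤ ENNReal.ofReal (2 * (t - s)) * energy k E₀ := by
  obtain ⟨M, hM, hmoment⟩ := exists_forall_lintegral_edist_sq_interpolate_le hk hE₀ hh
    hlim.bddAbove_range hE (hs.trans hst)
  obtain ⟨M', hM', hmoment'⟩ := exists_forall_lintegral_edist_sq_interpolate_le hk hE₀ hh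
    hlim.bddAbove_range hE hs
  have hrate : Tendsto (fun j ↦ ENNReal.ofReal (2 * (t - s + h j)) * energy k E₀) atTop
      (𝓝 (ENNReal.ofReal (2 * (t - s)) * energy k E₀)) := by
    refine ENNReal.Tendsto.mul_const (ENNReal.tendsto_ofReal ?_) (.inr (hE₀.energy_ne_top hk))
    simpa using (hlim.const_add (t - s)).const_mul 2
  exact W2sq_le_of_tendsto_symmDiff hA hB (fun j ↦ ((hE j).isAdmissible hk hE₀ _).volume_eq)
    (fun j ↦ ((hE j).isAdmissible hk hE₀ _).volume_eq) htA hsB (max_ne_top hM hM')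
    (fun j ↦ (hmoment j).trans (le_max_left _ _)) (fun j ↦ (hmoment' j).trans (le_max_right _ _))
    hrate fun j ↦ (hE j).W2sq_interpolate_le (hh j) hk hE₀ hs hst

theorem exists_subseq_tendsto_interpolate_isAdmissible (hk : IsKernel k)
    (hE₀ : IsInitialCondition E₀) (hh : ∀ j, 0 < h j) (hlim : Tendsto h atTop (𝓝 0))
    (hE : ∀ j, IsMinimizingMovement k (h j) E₀ (E j)) :
    ∃ φ : ℕ → ℕ, StrictMono φ ∧ ∃ Elim : ℝ → Set (EuclideanSpace ℝ (Fin d)),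
      (∀ T : ℝ, Tendsto (fun j ↦ ⨆ t ∈ Set.Icc 0 T,
        volume (interpolate (h (φ j)) (E (φ j)) t ∆ Elim t)) atTop (𝓝 0)) ∧
      (∀ t, 0 ≤ t → IsAdmissible (volume E₀) (energy k E₀) (Elim t)) ∧
      ∀ s t, 0 ≤ s → s ≤ t →
        W2sq (Elim t) (Elim s) ≤ ENNReal.ofReal (2 * (t - s)) * energy k E₀ := by
  obtain ⟨φ, hφ, Elim, hmeas, hunif⟩ := exists_subseq_tendsto_interpolate hk hE₀ hh hlim hE
  have hpointwise {t : ℝ} (ht : 0 ≤ t) :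
      Tendsto (fun j ↦ volume (interpolate (h (φ j)) (E (φ j)) t ∆ Elim t)) atTop (𝓝 0) :=
    tendsto_of_tendsto_of_tendsto_of_le_of_le tendsto_const_nhds (hunif t) (fun _ ↦ zero_le)
      fun _ ↦ le_iSup₂_of_le t (Set.right_mem_Icc.2 ht) le_rfl
  refine ⟨φ, hφ, Elim, hunif, fun t ht ↦ ?_, fun s t hs hst ↦ ?_⟩
  · exact .of_tendsto_symmDiff (fun j ↦ (hE (φ j)).isAdmissible hk hE₀ _)
      (hmeas t).nullMeasurableSet (hpointwise ht)
  · exact W2sq_le_of_tendsto_interpolate hk hE₀ (fun j ↦ hh (φ j)) (hlim.comp hφ.tendsto_atTop)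
      (fun j ↦ hE (φ j)) hs hst (hmeas t) (hmeas s) (hpointwise (hs.trans hst)) (hpointwise hs)

end Compactness

end FerroFlow

theorem mainTheorem2 (d : ℕ) (hd : 1 ≤ d) :
    ∃ C : ℝ, 0 < C ∧
      ∀ (k : EuclideanSpace ℝ (Fin d) → ℝ), FerroFlow.IsKernel k →
      ∀ (E₀ : Set (EuclideanSpace ℝ (Fin d))), FerroFlow.IsInitialCondition E₀ →
        -- the estimates for the discrete solutions
        (∀ (h : ℝ), 0 < h →
          ∀ (E : ℕ → Set (EuclideanSpace ℝ (Fin d))),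
            FerroFlow.IsMinimizingMovement k h E₀ E →
          ∀ s t : ℝ, 0 ≤ s → s < t → h ≤ t - s →
            FerroFlow.W2 (FerroFlow.interpolate h E t) (FerroFlow.interpolate h E s)
                ≤ ENNReal.ofReal C * FerroFlow.energy k E₀ ^ (1 / 2 : ℝ)
                  * ENNReal.ofReal (t - s) ^ (1 / 2 : ℝ) ∧
            volume (FerroFlow.interpolate h E t ∆ FerroFlow.interpolate h E s)
                ≤ ENNReal.ofReal C * volume E₀ ^ (1 / 4 : ℝ)
                  * FerroFlow.energy k E₀ ^ (3 / 4 : ℝ)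
                  * ENNReal.ofReal (t - s) ^ (1 / 4 : ℝ)) ∧
        -- compactness, and the estimates for the limit
        (∀ (h : ℕ → ℝ), (∀ j, 0 < h j) → Tendsto h atTop (𝓝 0) →
          ∀ (E : ℕ → ℕ → Set (EuclideanSpace ℝ (Fin d))),
            (∀ j, FerroFlow.IsMinimizingMovement k (h j) E₀ (E j)) →
          ∃ φ : ℕ → ℕ, StrictMono φ ∧
          ∃ Elim : ℝ → Set (EuclideanSpace ℝ (Fin d)),
            (∀ t : ℝ, 0 ≤ t → FerroFlow.HasFinitePerimeter (Elim t)) ∧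
            (∀ T : ℝ, 0 ≤ T →
              Tendsto (fun j => ⨆ t ∈ Set.Icc (0 : ℝ) T,
                  volume (FerroFlow.interpolate (h (φ j)) (E (φ j)) t ∆ Elim t))
                atTop (𝓝 0)) ∧
            (∀ s t : ℝ, 0 ≤ s → s < t →
              FerroFlow.W2 (Elim t) (Elim s)
                  ≤ ENNReal.ofReal C * FerroFlow.energy k E₀ ^ (1 / 2 : ℝ)
                    * ENNReal.ofReal (t - s) ^ (1 / 2 : ℝ) ∧
              volume (Elim t ∆ Elim s)
                  ≤ ENNReal.ofReal C * volume E₀ ^ (1 / 4 : ℝ)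
                    * FerroFlow.energy k E₀ ^ (3 / 4 : ℝ)
                    * ENNReal.ofReal (t - s) ^ (1 / 4 : ℝ))) := by
  obtain ⟨C, hC, hestimate⟩ := FerroFlow.exists_holder_estimate d
  refine ⟨C, hC, fun k hk E₀ hE₀ ↦ ⟨fun h hh E hE s t hs hst hhst ↦ ?_, fun h hh hlim E hE ↦ ?_⟩⟩
  · refine hestimate hE₀.volume_ne_top (hE₀.energy_ne_top hk) (hE.isAdmissible hk hE₀ _)
      (hE.isAdmissible hk hE₀ _) ((hE.W2sq_interpolate_le hh hk hE₀ hs hst.le).trans ?_)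
    gcongr ENNReal.ofReal ?_ * _
    linarith
  · obtain ⟨φ, hφ, Elim, hunif, hadm, hW⟩ :=
      FerroFlow.exists_subseq_tendsto_interpolate_isAdmissible hk hE₀ hh hlim hE
    refine ⟨φ, hφ, Elim, fun t ht ↦ ⟨(hadm t ht).measurable,
      (hadm t ht).perimeter_le.trans_lt (hE₀.energy_ne_top hk).lt_top⟩, fun T _ ↦ hunif T,
      fun s t hs hst ↦ hestimate hE₀.volume_ne_top (hE₀.energy_ne_top hk)
        (hadm t (hs.trans hst.le)) (hadm s hs) ((hW s t hs hst.le).trans ?_)⟩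
    gcongr ENNReal.ofReal ?_ * _
    linarith
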